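/- **Setting.** Let $\vec p,\vec q,\vec r$ be disjoint tuples of Boolean variables, $A(\vec p,\vec q)$ and $B(\vec p,\vec r)$ CNF formulas without tautological clauses, and let $$\mathcal F^b=\exists \vec p\,\forall b\,\mathcal Q\vec q\,\mathcal Q\vec r.\,\big[(A(\vec p,\vec q)\vee b)\wedge(B(\vec p,\vec r)\vee\neg b)\big],$$ where $b$ is a new universal variable, the variables of $\vec q$ and of $\vec r$ are quantified arbitrarily, and the matrix is put into CNF by inserting $b$ into each clause of $A$ and $\neg b$ into each clause of $B$. The index $\mathrm{ind}(x)$ of a variable is its position in the prefix. A strategy for the universal player gives, for each universal variable $u$, a function from the assignments of the variables of smaller index to $\{0,1\}$; it is winning if the matrix is false under every total assignment in which all universal variables follow the strategy. In particular its part for $b$ is a Boolean function $\sigma(\vec p)$. **IRM-calc.** The lines are sets of annotated existential literals $l^\sigma$, where $\sigma$ is a partial map from universal variables of index less than $\mathrm{ind}(l)$ to $\{0,1,*\}$. Write $l^{[\sigma]}$ for $l$ annotated with the restriction of $\sigma$ to variables of index less than $\mathrm{ind}(l)$, write $\sigma\circ\tau$ for the map that equals $\sigma$ on $\mathrm{dom}(\sigma)$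 and $\tau$ on $\mathrm{dom}(\tau)\setminus\mathrm{dom}(\sigma)$, and let $\mathrm{inst}(\tau,C)=\{l^{[\sigma\circ\tau]} : l^\sigma\in C\}$. The rules are: * Axiom: for a clause $C$ of the matrix, $\{l^{[\tau]} : l\in C \text{ existential}\}$, where $\tau$ is the assignment to the universal variables of $C$ that falsifies their literals in $C$. * Instantiation: from $C$ infer $\mathrm{inst}(\tau,C)$, for a partial $\{0,1\}$-assignment $\tau$ to universal variables. * Merging: from $C\vee l^{\mu}\vee l^{\sigma}$ with $\mathrm{dom}(\mu)=\mathrm{dom}(\sigma)$ infer $C\vee l^{\xi}$, where $\xi$ has the same domain, agrees with $\mu$ and $\sigma$ where they agree, and is $*$ elsewhere. * Resolution: from $x^{\tau\cup\xi}\vee C_1$ and $\neg x^{\tau\cup\sigma}\vee C_2$ infer $\mathrm{inst}(\sigma,C_1)\cup\mathrm{inst}(\xi,C_2)$, where $\mathrm{dom}(\tau),\mathrm{dom}(\xi),\mathrm{dom}(\sigma)$ are pairwise disjoint and $\tau$ takes values in $\{0,1\}$ only. A refutation is a sequence of lines, each inferred from earlier lines by a rule, that ends with the empty clause. Each line is written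 with its rule, the line numbers of its premises and, where applicable, its matrix clause or its pivot variable; numbers are written in binary, and each variable name is an index together with a mark telling whether the variable belongs to $\vec p$, to $\vec q$, to $\vec r$, or is $b$. **Theorem.** 1. There is a polynomial-time algorithm (a multi-stack Turing machine, running in time polynomial in the length of the written proof) that turns every IRM-calc refutation $\pi$ of a formula $\mathcal F^b$ as above into a Boolean circuit (with gates $0,1,\neg,\wedge,\vee$ and inputs $\vec p$) that computes $\sigma(\vec p)$, the part for the variable $b$ of some winning strategy of the universal player in $\mathcal F^b$. 2. There is a polynomial-time algorithm that turns every IRM-calc refutation $\pi$ of a formula $\mathcal F^b$ as above in which the variables $\vec p$ appear only positively in $A(\vec p,\vec q)$ into a monotone Boolean circuit (without $\neg$ gates) that computes $\sigma(\vec p)$, the part for $b$ of some winning strategy of the universal player in $\mathcal F^b$. -/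

import Mathlib

namespace IRM

/-! ### Quantified boolean formulas in closed prenex form with a CNF matrix -/

inductive Quant
  | ex
  | all
  deriving DecidableEq

structure Literal (V : Type) where
  var : V
  pos : Bool
  deriving DecidableEq

/-- A clause is the set of its literals, a CNF the set of its clauses. -/
abbrev CNF (V : Type) := Finset (Finset (Literal V))

def NonTautological {V : Type} (C : Finset (Literal V)) : Prop :=
  ∀ x : V, ¬ ((⟨x, true⟩ : Literal V) ∈ C ∧ (⟨x, false⟩ : Literal V) ∈ C)

/-- `Q₁ x₁ … Qₙ xₙ. matrix`; the list `pre` is the quantifier prefix. -/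
structure QBF (V : Type) where
  pre : List (Quant × V)
  matrix : CNF V
  nodup : (pre.map Prod.snd).Nodup
  closed : ∀ C ∈ matrix, ∀ l ∈ C, l.var ∈ pre.map Prod.snd
  nontaut : ∀ C ∈ matrix, NonTautological C

namespace QBF

variable {V : Type} [DecidableEq V] (F : QBF V)

abbrev vars : List V := F.pre.map Prod.snd

/-- The index of a variable is its position in the prefix. -/
def ind (x : V) : ℕ := F.vars.idxOf x

abbrev IsEx (x : V) : Prop := (Quant.ex, x) ∈ F.pre

abbrev IsUniv (x : V) : Prop := (Quant.all, x) ∈ F.pre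

/-- The matrix evaluates to `1` under the assignment `α`. -/
def MatrixTrue (α : V → Bool) : Prop := ∀ C ∈ F.matrix, ∃ l ∈ C, α l.var = l.pos

/-- The variables that have a value when it is the turn of `u`. -/
def Before (u : V) : Type := {x : V // x ∈ F.vars ∧ F.ind x < F.ind u}

/-- A strategy for the universal player: for every universal variable `u`, a function from the
assignments to the variables of smaller index to truth values. -/
def UnivStrategy : Type := ∀ u : V, F.IsUniv u → (F.Before u → Bool) → Bool

/-- The universal player wins every game in which the strategy is followed. -/
def IsWinning (S : F.UnivStrategy) : Prop :=
  ∀ α : V → Bool, (∀ (u : V) (hu : F.IsUniv u), α u = S u hu (fun x => α x.1)) →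
    ¬ F.MatrixTrue α

end QBF

/-! ### Annotated clauses -/

/-- The values `0`, `1` and `*` of annotations. -/
inductive Val
  | zero
  | one
  | star
  deriving DecidableEq

/-- A partial assignment; `none` means that the variable is not in the domain. -/
abbrev Ann (V : Type) := V → Option Val

namespace Ann

variable {V : Type}

/-- The completion of `τ` by `μ`: `μ` provides the values that `τ` does not define. For disjoint
domains it is the union. -/
def complete (τ μ : Ann V) : Ann V := fun u => (τ u).or (μ u)

def DisjointDom (τ μ : Ann V) : Prop := ∀ u, τ u = none ∨ μ u = none

def SameDom (τ μ : Ann V) : Prop := ∀ u, τ u = none ↔ μ u = none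

def StarFree (τ : Ann V) : Prop := ∀ u, τ u ≠ some Val.star

/-- For annotations with the same domain: common values are kept, different ones become `*`. -/
def merge (μ σ : Ann V) : Ann V := fun u => if μ u = σ u then μ u else some Val.star

end Ann

/-- An annotated literal `l^σ`. -/
structure ALit (V : Type) where
  lit : Literal V
  ann : Ann V

abbrev AClause (V : Type) := Set (ALit V)

namespace QBF

variable {V : Type} [DecidableEq V] (F : QBF V)

/-- The annotated literal `l^[σ]`: only the part of `σ` on variables of index less than that
of `l` is kept. -/
def restrict (l : Literal V) (σ : Ann V) : ALit V :=
  ⟨l, fun u => if F.ind u < F.ind l.var then σ u else none⟩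

/-- `inst(τ, C)` -/
def inst (τ : Ann V) (C : AClause V) : AClause V :=
  {m | ∃ l ∈ C, m = F.restrict l.lit (l.ann.complete τ)}

/-- The assignment to the universal variables of `C` that makes their literals in `C` false. -/
def falsifier (C : Finset (Literal V)) : Ann V := fun u =>
  if F.IsUniv u then
    if (⟨u, true⟩ : Literal V) ∈ C then some Val.zero
    else if (⟨u, false⟩ : Literal V) ∈ C then some Val.one
    else none
  else none

/-! The four rules of the calculus. -/

def IsAxiom (C : Finset (Literal V)) (E : AClause V) : Prop :=
  C ∈ F.matrix ∧ E = {m | ∃ l ∈ C, F.IsEx l.var ∧ m = F.restrict l (F.falsifier C)}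

/-- From `D` infer `E` by instantiation. -/
def IsInstantiation (D E : AClause V) : Prop :=
  ∃ τ : Ann V, (∀ u, τ u ≠ none → F.IsUniv u) ∧ τ.StarFree ∧ E = F.inst τ D

/-- From `D = C ∨ b^μ ∨ b^σ` infer `E = C ∨ b^ξ`. -/
def IsMerging (D E : AClause V) : Prop :=
  ∃ (C : AClause V) (b : Literal V) (μ σ : Ann V), μ.SameDom σ ∧
    D = insert ⟨b, μ⟩ (insert ⟨b, σ⟩ C) ∧ E = insert ⟨b, μ.merge σ⟩ C

/-- From `D₁ = x^(τ ∪ ξ) ∨ C₁` and `D₂ = ¬x^(τ ∪ σ) ∨ C₂` infer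
`E = inst(σ, C₁) ∪ inst(ξ, C₂)`. -/
def IsResolution (x : V) (D₁ D₂ E : AClause V) : Prop :=
  ∃ (τ ξ σ : Ann V) (C₁ C₂ : AClause V),
    τ.DisjointDom ξ ∧ τ.DisjointDom σ ∧ ξ.DisjointDom σ ∧ τ.StarFree ∧
    D₁ = insert ⟨⟨x, true⟩, τ.complete ξ⟩ C₁ ∧
    D₂ = insert ⟨⟨x, false⟩, τ.complete σ⟩ C₂ ∧
    E = F.inst σ C₁ ∪ F.inst ξ C₂

end QBF

/-! ### Proofs as finite objects

A proof is a list of lines, each of them an annotated clause, written down as a list of annotated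
literals, and the rule by which it is inferred. Premises are given by their line numbers, counted
from `0`. -/

structure RawALit (V : Type) where
  lit : Literal V
  ann : List (V × Val)

inductive Rule (V : Type)
  /-- axiom, from the given clause of the matrix -/
  | ax (C : List (Literal V))
  | inst (i : ℕ)
  | merge (i : ℕ)
  /-- resolution on `x`; line `i` contains the positive and line `j` the negative pivot -/
  | res (i j : ℕ) (x : V)

structure Line (V : Type) where
  rule : Rule V
  clause : List (RawALit V)

abbrev Proof (V : Type) := List (Line V)

section

variable {V : Type} [DecidableEq V]

def RawALit.denote (l : RawALit V) : ALit V := ⟨l.lit, fun u => l.ann.lookup u⟩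

def Line.denote (ln : Line V) : AClause V := {m | ∃ l ∈ ln.clause, m = l.denote}

/-- The line `ln` is correctly inferred from the lines `prev` before it. -/
def Line.Valid (F : QBF V) (prev : List (Line V)) (ln : Line V) : Prop :=
  match ln.rule with
  | .ax C => F.IsAxiom C.toFinset ln.denote
  | .inst i => ∃ d, prev[i]? = some d ∧ F.IsInstantiation d.denote ln.denote
  | .merge i => ∃ d, prev[i]? = some d ∧ QBF.IsMerging d.denote ln.denote
  | .res i j x => ∃ d₁ d₂, prev[i]? = some d₁ ∧ prev[j]? = some d₂ ∧
      F.IsResolution x d₁.denote d₂.denote ln.denote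

/-- `π` is an IRM-calc refutation of `F`: its last line is the empty clause. -/
def IsRefutation (F : QBF V) (π : Proof V) : Prop :=
  (∀ (k : ℕ) (hk : k < π.length), Line.Valid F (π.take k) π[k]) ∧
  ∃ ln, π.getLast? = some ln ∧ ln.denote = ∅

end

/-! ### Boolean circuits -/

/-- The numbers in `not`, `and`, `or` are the positions of the gates that are fed in;
`input i` reads the `i`-th input variable. -/
inductive Gate
  | const (v : Bool)
  | input (i : ℕ)
  | not (j : ℕ)
  | and (j k : ℕ)
  | or (j k : ℕ)

namespace Gate

def preds : Gate → List ℕ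
  | const _ => []
  | input _ => []
  | not j => [j]
  | and j k => [j, k]
  | or j k => [j, k]

/-- The value of a gate, given the values of the gates before it. -/
def eval (a : ℕ → Bool) (vals : List Bool) : Gate → Bool
  | const v => v
  | input i => a i
  | not j => !(vals.getD j false)
  | and j k => vals.getD j false && vals.getD k false
  | or j k => vals.getD j false || vals.getD k false

end Gate

/-- The gates in topological order; the last one is the output. -/
abbrev Circuit := List Gate

namespace Circuit

/-- `C` is a circuit with inputs `0, …, n - 1`. -/
def WellFormed (C : Circuit) (n : ℕ) : Prop :=
  C ≠ [] ∧ (∀ (k : ℕ) (hk : k < C.length), ∀ j ∈ C[k].preds, j < k) ∧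
    ∀ i, Gate.input i ∈ C → i < n

def Monotone (C : Circuit) : Prop := ∀ j, Gate.not j ∉ C

def values (C : Circuit) (a : ℕ → Bool) : List Bool :=
  C.foldl (fun vals g => vals ++ [g.eval a vals]) []

def eval (C : Circuit) (a : ℕ → Bool) : Bool := (C.values a).getLastD false

end Circuit

/-! ### The formulas `F^b` -/

inductive Name
  | p (i : ℕ)
  | b
  | q (i : ℕ)
  | r (i : ℕ)
  deriving DecidableEq

/-- The data of `∃p Qq Qr. A(p, q) ∧ B(p, r)`, where `p`, `q`, `r` are tuples of `nP`, `nQ` and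
`nR` variables, and `quQ`, `quR` give the quantifiers of the variables in `q` and `r`. -/
structure Setting where
  nP : ℕ
  nQ : ℕ
  nR : ℕ
  quQ : ℕ → Quant
  quR : ℕ → Quant
  A : CNF Name
  B : CNF Name
  A_vars : ∀ C ∈ A, ∀ l ∈ C, (∃ i < nP, l.var = .p i) ∨ ∃ i < nQ, l.var = .q i
  B_vars : ∀ C ∈ B, ∀ l ∈ C, (∃ i < nP, l.var = .p i) ∨ ∃ i < nR, l.var = .r i
  A_nontaut : ∀ C ∈ A, NonTautological C
  B_nontaut : ∀ C ∈ B, NonTautological C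

namespace Setting

variable (F : Setting)

def preB : List (Quant × Name) :=
  (List.range F.nP).map (fun i => (Quant.ex, Name.p i)) ++ (Quant.all, Name.b) ::
    ((List.range F.nQ).map (fun i => (F.quQ i, Name.q i)) ++
      (List.range F.nR).map (fun i => (F.quR i, Name.r i)))

def matrixB : CNF Name :=
  F.A.image (fun C => insert ⟨Name.b, true⟩ C) ∪ F.B.image (fun C => insert ⟨Name.b, false⟩ C)

theorem preB_nodup : (F.preB.map Prod.snd).Nodup := by
  have h : ∀ (n : ℕ) (f : ℕ → Name), Function.Injective f → ((List.range n).map f).Nodup :=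
    fun n f hf => List.nodup_range.map hf
  have hp := h F.nP Name.p (fun _ _ h => by simpa using h)
  have hq := h F.nQ Name.q (fun _ _ h => by simpa using h)
  have hr := h F.nR Name.r (fun _ _ h => by simpa using h)
  simp only [preB, List.map_append, List.map_cons, List.map_map, Function.comp_def]
  rw [List.nodup_append, List.nodup_cons, List.nodup_append]
  refine ⟨hp, ⟨by simp, hq, hr, by simp⟩, ?_⟩
  intro x hx y hy
  simp only [List.mem_map, List.mem_cons, List.mem_append] at hx hy
  rcases hx with ⟨i, _, rfl⟩
  rcases hy with rfl | ⟨j, _, rfl⟩ | ⟨j, _, rfl⟩ <;> simp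

theorem matrixB_closed : ∀ C ∈ F.matrixB, ∀ l ∈ C, l.var ∈ F.preB.map Prod.snd := by
  intro C hC l hl
  simp only [matrixB, Finset.mem_union, Finset.mem_image] at hC
  rcases hC with ⟨D, hD, rfl⟩ | ⟨D, hD, rfl⟩ <;> rcases Finset.mem_insert.1 hl with rfl | hl
  · simp [preB]
  · rcases F.A_vars D hD l hl with ⟨i, hi, h⟩ | ⟨i, hi, h⟩ <;> simp [preB, h, hi]
  · simp [preB]
  · rcases F.B_vars D hD l hl with ⟨i, hi, h⟩ | ⟨i, hi, h⟩ <;> simp [preB, h, hi]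

theorem matrixB_nontaut : ∀ C ∈ F.matrixB, NonTautological C := by
  intro C hC x hx
  simp only [matrixB, Finset.mem_union, Finset.mem_image] at hC
  rcases hC with ⟨D, hD, rfl⟩ | ⟨D, hD, rfl⟩ <;> simp only [Finset.mem_insert] at hx
  · rcases hx with ⟨h1 | h1, h2 | h2⟩
    · simp at h2
    · cases h1
      have := F.A_vars D hD _ h2
      simp at this
    · simp at h2
    · exact F.A_nontaut D hD x ⟨h1, h2⟩
  · rcases hx with ⟨h1 | h1, h2 | h2⟩
    · simp at h1
    · simp at h1
    · cases h2
      have := F.B_vars D hD _ h1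
      simp at this
    · exact F.B_nontaut D hD x ⟨h1, h2⟩

/-- `F^b = ∃p ∀b Qq Qr. (A(p, q) ∨ b) ∧ (B(p, r) ∨ ¬b)`, with the literals `b` and `¬b`
inserted into the clauses. -/
def withB : QBF Name where
  pre := F.preB
  matrix := F.matrixB
  nodup := F.preB_nodup
  closed := F.matrixB_closed
  nontaut := F.matrixB_nontaut

theorem univ_b : F.withB.IsUniv Name.b := by simp [QBF.IsUniv, withB, preB]

/-- The variables in `p` appear only positively in `A`. -/
def PositiveInA : Prop := ∀ C ∈ F.A, ∀ i, (⟨Name.p i, false⟩ : Literal Name) ∉ C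

/-- `C` is a circuit with inputs `p` that computes the part for `b` of some winning strategy
of the universal player in `F^b`. -/
def ComputesB (C : Circuit) : Prop :=
  C.WellFormed F.nP ∧
  ∃ S : F.withB.UnivStrategy, F.withB.IsWinning S ∧
    ∀ α : Name → Bool, C.eval (fun i => α (Name.p i)) = S Name.b F.univ_b (fun x => α x.1)

end Setting

/-! ### Encoding of proofs and circuits as words over a finite alphabet

Numbers are written in binary. -/

inductive Sym
  | bit (v : Bool)
  | endNat
  | cons
  | nil
  | varP
  | varB
  | varQ
  | varR
  | sign (v : Bool)
  | zero
  | one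
  | star
  | ruleAx
  | ruleInst
  | ruleMerge
  | ruleRes
  | gateConst (v : Bool)
  | gateInput
  | gateNot
  | gateAnd
  | gateOr
  deriving DecidableEq, Fintype

def encodeNat (n : ℕ) : List Sym := (Computability.encodeNat n).map Sym.bit ++ [Sym.endNat]

def encodeList {α : Type} (e : α → List Sym) : List α → List Sym
  | [] => [Sym.nil]
  | x :: l => Sym.cons :: (e x ++ encodeList e l)

def encodeName : Name → List Sym
  | .p i => Sym.varP :: encodeNat i
  | .b => [Sym.varB]
  | .q i => Sym.varQ :: encodeNat i
  | .r i => Sym.varR :: encodeNat i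

def encodeLiteral (l : Literal Name) : List Sym := Sym.sign l.pos :: encodeName l.var

def encodeVal : Val → Sym
  | .zero => Sym.zero
  | .one => Sym.one
  | .star => Sym.star

def encodeRawALit (l : RawALit Name) : List Sym :=
  encodeLiteral l.lit ++ encodeList (fun c => encodeVal c.2 :: encodeName c.1) l.ann

def encodeRule : Rule Name → List Sym
  | .ax C => Sym.ruleAx :: encodeList encodeLiteral C
  | .inst i => Sym.ruleInst :: encodeNat i
  | .merge i => Sym.ruleMerge :: encodeNat i
  | .res i j x => Sym.ruleRes :: (encodeNat i ++ (encodeNat j ++ encodeName x))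

def encodeLine (ln : Line Name) : List Sym :=
  encodeRule ln.rule ++ encodeList encodeRawALit ln.clause

def encodeProof : Proof Name → List Sym := encodeList encodeLine

def encodeGate : Gate → List Sym
  | .const v => [Sym.gateConst v]
  | .input i => Sym.gateInput :: encodeNat i
  | .not j => Sym.gateNot :: encodeNat j
  | .and j k => Sym.gateAnd :: (encodeNat j ++ encodeNat k)
  | .or j k => Sym.gateOr :: (encodeNat j ++ encodeNat k)

def encodeCircuit : Circuit → List Sym := encodeList encodeGate

/-! The encodings are faithful: a word is the code of at most one object, and no code is a proper
prefix of another one. -/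

def PrefixFree {α : Type} (e : α → List Sym) : Prop :=
  ∀ x y s t, e x ++ s = e y ++ t → x = y ∧ s = t

theorem PrefixFree.injective {α : Type} {e : α → List Sym} (h : PrefixFree e) :
    Function.Injective e := fun x y hxy => (h x y [] [] (by rw [hxy])).1

theorem PrefixFree.list {α : Type} {e : α → List Sym} (h : PrefixFree e) :
    PrefixFree (encodeList e) := by
  intro x
  induction x with
  | nil => intro y s t hst; cases y <;> simp_all [encodeList]
  | cons a l ih =>
    intro y s t hst
    cases y with
    | nil => simp [encodeList] at hst
    | cons a' l' =>
      simp only [encodeList, List.cons_append, List.append_assoc, List.cons.injEq,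
        true_and] at hst
      obtain ⟨rfl, h2⟩ := h _ _ _ _ hst
      obtain ⟨rfl, h3⟩ := ih _ _ _ h2
      exact ⟨rfl, h3⟩

theorem encodeNat_prefixFree : PrefixFree encodeNat := by
  have key : ∀ (u v : List Bool) (s t : List Sym),
      u.map Sym.bit ++ Sym.endNat :: s = v.map Sym.bit ++ Sym.endNat :: t → u = v ∧ s = t := by
    intro u
    induction u with
    | nil => intro v s t h; cases v <;> simp_all
    | cons c u ih =>
      intro v s t h
      cases v with
      | nil => simp at h
      | cons c' v =>
        simp only [List.map_cons, List.cons_append, List.cons.injEq, Sym.bit.injEq] at h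
        obtain ⟨rfl, h2⟩ := ih _ _ _ h.2
        exact ⟨by rw [h.1], h2⟩
  intro x y s t h
  obtain ⟨h1, h2⟩ := key _ _ s t (by simpa [encodeNat] using h)
  refine ⟨?_, h2⟩
  rw [← Computability.decode_encodeNat x, h1, Computability.decode_encodeNat]

theorem encodeName_prefixFree : PrefixFree encodeName := by
  intro x y s t h
  cases x <;> cases y <;> simp [encodeName] at h ⊢ <;>
    first | exact h | exact encodeNat_prefixFree _ _ _ _ h

theorem encodeLiteral_prefixFree : PrefixFree encodeLiteral := by
  rintro ⟨x, c⟩ ⟨y, d⟩ s t h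
  simp only [encodeLiteral, List.cons_append, List.cons.injEq, Sym.sign.injEq] at h
  obtain ⟨rfl, h2⟩ := encodeName_prefixFree _ _ _ _ h.2
  exact ⟨by rw [h.1], h2⟩

theorem encodeRawALit_prefixFree : PrefixFree encodeRawALit := by
  have hc : PrefixFree (fun c : Name × Val => encodeVal c.2 :: encodeName c.1) := by
    rintro ⟨x, c⟩ ⟨y, d⟩ s t h
    simp only [List.cons_append, List.cons.injEq] at h
    obtain ⟨rfl, h2⟩ := encodeName_prefixFree _ _ _ _ h.2
    refine ⟨?_, h2⟩
    cases c <;> cases d <;> simp_all [encodeVal]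
  rintro ⟨x, c⟩ ⟨y, d⟩ s t h
  simp only [encodeRawALit, List.append_assoc] at h
  obtain ⟨rfl, h2⟩ := encodeLiteral_prefixFree _ _ _ _ h
  obtain ⟨rfl, h3⟩ := hc.list _ _ _ _ h2
  exact ⟨rfl, h3⟩

theorem encodeRule_prefixFree : PrefixFree encodeRule := by
  intro x y s t h
  cases x <;> cases y <;> simp only [encodeRule, List.cons_append, List.append_assoc,
    List.cons.injEq, reduceCtorEq, false_and, true_and] at h
  · obtain ⟨rfl, h1⟩ := encodeLiteral_prefixFree.list _ _ _ _ h
    exact ⟨rfl, h1⟩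
  · obtain ⟨rfl, h1⟩ := encodeNat_prefixFree _ _ _ _ h
    exact ⟨rfl, h1⟩
  · obtain ⟨rfl, h1⟩ := encodeNat_prefixFree _ _ _ _ h
    exact ⟨rfl, h1⟩
  · obtain ⟨rfl, h1⟩ := encodeNat_prefixFree _ _ _ _ h
    obtain ⟨rfl, h2⟩ := encodeNat_prefixFree _ _ _ _ h1
    obtain ⟨rfl, h3⟩ := encodeName_prefixFree _ _ _ _ h2
    exact ⟨rfl, h3⟩

theorem encodeProof_prefixFree : PrefixFree encodeProof := by
  apply PrefixFree.list
  rintro ⟨x, c⟩ ⟨y, d⟩ s t h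
  simp only [encodeLine, List.append_assoc] at h
  obtain ⟨rfl, h2⟩ := encodeRule_prefixFree _ _ _ _ h
  obtain ⟨rfl, h3⟩ := encodeRawALit_prefixFree.list _ _ _ _ h2
  exact ⟨rfl, h3⟩

theorem encodeCircuit_prefixFree : PrefixFree encodeCircuit := by
  apply PrefixFree.list
  intro x y s t h
  cases x <;> cases y <;> simp only [encodeGate, List.cons_append, List.append_assoc,
    List.nil_append, List.cons.injEq, reduceCtorEq, false_and, true_and,
    Sym.gateConst.injEq] at h
  · exact ⟨by rw [h.1], h.2⟩
  · obtain ⟨rfl, h1⟩ := encodeNat_prefixFree _ _ _ _ h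
    exact ⟨rfl, h1⟩
  · obtain ⟨rfl, h1⟩ := encodeNat_prefixFree _ _ _ _ h
    exact ⟨rfl, h1⟩
  · obtain ⟨rfl, h1⟩ := encodeNat_prefixFree _ _ _ _ h
    obtain ⟨rfl, h2⟩ := encodeNat_prefixFree _ _ _ _ h1
    exact ⟨rfl, h2⟩
  · obtain ⟨rfl, h1⟩ := encodeNat_prefixFree _ _ _ _ h
    obtain ⟨rfl, h2⟩ := encodeNat_prefixFree _ _ _ _ h1
    exact ⟨rfl, h2⟩

/-- `f` turns proofs into circuits and is computed by a Turing machine in time polynomial in the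
size of the proof. -/
def PolyTimeExtraction (f : Proof Name → Circuit) : Prop :=
  Nonempty (Turing.TM2ComputableInPolyTime encodeProof encodeCircuit f)

end IRM

/-! Lines of a refutation are read as statements about a game. Fix an assignment to the variables p
and one half of the matrix, with bit g = 0 for A and g = 1 for B. On the prefix of that half the
universal player can falsify the half, unless some literal of the line becomes true after moves that
its annotation permits (`Forces`). At a universal variable the player either commits to a value c,
keeping the literals annotated with c or `*`, or abstains: this must work for both values and keeps
only literals with no annotation there. Axioms have this property because the player can follow the
falsifying assignment (`Forces.axiom_clause`). Instantiation and merging preserve it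
(`Forces.inst`). Resolution does too, because the annotations of the two pivots make the moves of
the two premises compatible (`Forces.resolution`).

Interpolation attaches a bit g to every line so that, under the given p, either a p-literal of the
line is true, or the game on half g is forced by the literals of the line on that half alone
(`Setting.Claim`). An axiom gets the bit of its half. A pivot in p selects the premise whose pivot
is false. A pivot in q is foreign to B, so a premise with bit 1 survives without its pivot and the
bits combine by ∨; dually a pivot in r gives ∧. For the empty line only the game remains: setting b
to g and then playing it wins (`Setting.exists_winning`).

If p is positive in A, claims with bit 0 may insist on a positive true p-literal. A negative pivot
in a premise with bit 0 then never matters, and the selector can be replaced by the monotone (g₁ ∨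
p) ∧ g₂.

The circuit has one block of sixteen gates per line, determined by the rule, the number of the line
and the numbers of the premises. Gate positions are written as four fixed digits followed by a line
number, so one pass over the proof that only copies digits and increments a counter writes the
circuit (`run_machine`); reversing the output costs no more than its length. -/

namespace IRM

/-! ### Soundness of the calculus as a game -/

namespace Val

def ofBool : Bool → Val
  | false => zero
  | true => one

/-- `b` arises from the annotation value `a` by possibly turning a defined value into `*`. -/
def Coarsens (a b : Option Val) : Prop := b = a ∨ (a ≠ none ∧ b = some star)

theorem Coarsens.refl (a : Option Val) : Coarsens a a := Or.inl rfl

/-- The annotation value `a` allows the universal player to play `c`. -/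
def Allows (c : Bool) (a : Option Val) : Prop := a = some (ofBool c) ∨ a = some star

theorem Allows.coarsens {c : Bool} {a b : Option Val} (h : Allows c a) (hab : Coarsens a b) :
    Allows c b := by
  rcases hab with rfl | ⟨-, rfl⟩
  · exact h
  · exact Or.inr rfl

theorem Allows.ne_none {c : Bool} {a : Option Val} (h : Allows c a) : a ≠ none := by
  rcases h with rfl | rfl <;> simp

theorem exists_allows {a : Option Val} (h : a ≠ none) : ∃ c, Allows c a := by
  rcases a with _ | _ | _ | _
  · exact absurd rfl h
  · exact ⟨false, Or.inl rfl⟩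
  · exact ⟨true, Or.inl rfl⟩
  · exact ⟨true, Or.inr rfl⟩

end Val

section Game

variable {V : Type}

open Function

/-- All literals of `D` belong to existential variables of the prefix `L`. -/
def Within (L : List (Quant × V)) (D : AClause V) : Prop := ∀ l ∈ D, (Quant.ex, l.lit.var) ∈ L

theorem Within.subset {L : List (Quant × V)} {D D' : AClause V} (h : Within L D) (h' : D' ⊆ D) :
    Within L D' := fun l hl => h l (h' hl)

theorem Within.tail_ex {L : List (Quant × V)} {D : AClause V} {x : V}
    (h : Within ((Quant.ex, x) :: L) D) : Within L {l ∈ D | l.lit.var ≠ x} := by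
  rintro l ⟨hl, hx⟩
  simpa [hx] using h l hl

theorem Within.tail_all {L : List (Quant × V)} {D : AClause V} {u : V}
    (h : Within ((Quant.all, u) :: L) D) : Within L D := fun l hl => by simpa using h l hl

/-- `m` results from `l` by completing the annotation with `τ` and by coarsening. -/
def ALit.InstOf (lt : V → V → Prop) (τ : Ann V) (l m : ALit V) : Prop :=
  m.lit = l.lit ∧ ∀ u, lt u l.lit.var → Val.Coarsens (l.ann.complete τ u) (m.ann u)

variable {lt : V → V → Prop}

theorem ALit.InstOf.of_coarsens {l m : ALit V} (h : m.lit = l.lit)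
    (h' : ∀ u, Val.Coarsens (l.ann u) (m.ann u)) : l.InstOf lt (fun _ => none) m :=
  ⟨h, fun u _ => by simpa [Ann.complete] using h' u⟩

variable [DecidableEq V]

/-- In the game on the prefix `L` from the position `α`, the universal player can reach `M`,
unless a literal of `D` becomes true. In the latter case the moves made so far agree with the
annotation of that literal. -/
def Forces (M : (V → Bool) → Prop) : List (Quant × V) → (V → Bool) → AClause V → Prop
  | [], α, _ => M α
  | (Quant.ex, x) :: L, α, D =>
    ∀ v, (∃ l ∈ D, l.lit = ⟨x, v⟩) ∨ Forces M L (update α x v) {l ∈ D | l.lit.var ≠ x}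
  | (Quant.all, u) :: L, α, D =>
    (∃ c, Forces M L (update α u c) {l ∈ D | Val.Allows c (l.ann u)}) ∨
      ∀ c, Forces M L (update α u c) {l ∈ D | l.ann u = none}

variable {M : (V → Bool) → Prop}

/-- The player keeps the old moves and follows `τ` where the old play abstains. A committed move
stays permitted, since `τ` never overrides a defined value and coarsening only relaxes it.
Abstention remains possible where `τ` is undefined, because coarsening never defines a value. -/
theorem Forces.inst {L : List (Quant × V)} (hL : L.Pairwise fun a b => lt a.2 b.2) {τ : Ann V} :
    ∀ {α : V → Bool} {D E : AClause V}, Within L D → Forces M L α D →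
      (∀ l ∈ D, ∃ m ∈ E, l.InstOf lt τ m) → Forces M L α E := by
  induction L with
  | nil => exact fun _ h _ => h
  | cons a L ih =>
    obtain ⟨hlt, hL'⟩ := List.pairwise_cons.1 hL
    intro α D E hD h hDE
    rcases a with ⟨_ | _, x⟩
    · intro v
      rcases h v with ⟨l, hl, hx⟩ | h
      · obtain ⟨m, hm, hlm⟩ := hDE l hl
        exact Or.inl ⟨m, hm, hlm.1.trans hx⟩
      · refine Or.inr (ih hL' hD.tail_ex h ?_)
        rintro l ⟨hl, hx⟩
        obtain ⟨m, hm, hlm⟩ := hDE l hl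
        exact ⟨m, ⟨hm, by rwa [hlm.1]⟩, hlm⟩
    · have hlt' : ∀ l ∈ D, lt x l.lit.var := fun l hl => hlt _ (hD.tail_all l hl)
      rcases h with ⟨c, h⟩ | h
      · refine Or.inl ⟨c, ih hL' (hD.tail_all.subset fun l hl => hl.1) h ?_⟩
        rintro l ⟨hl, hx⟩
        obtain ⟨m, hm, hlm⟩ := hDE l hl
        refine ⟨m, ⟨hm, Val.Allows.coarsens ?_ (hlm.2 x (hlt' l hl))⟩, hlm⟩
        rcases hx with hx | hx <;> simp [Ann.complete, hx, Val.Allows]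
      · by_cases hτ : τ x = none
        · refine Or.inr fun c => ih hL' (hD.tail_all.subset fun l hl => hl.1) (h c) ?_
          rintro l ⟨hl, hx⟩
          obtain ⟨m, hm, hlm⟩ := hDE l hl
          refine ⟨m, ⟨hm, ?_⟩, hlm⟩
          simpa [Ann.complete, hx, hτ, Val.Coarsens] using hlm.2 x (hlt' l hl)
        -- Abstention offers both values, so the player can now commit to one allowed by `τ x`; the
        -- literals without a value at `x` receive theirs from `τ`.
        · obtain ⟨c, hc⟩ := Val.exists_allows hτ
          refine Or.inl ⟨c, ih hL' (hD.tail_all.subset fun l hl => hl.1) (h c) ?_⟩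
          rintro l ⟨hl, hx⟩
          obtain ⟨m, hm, hlm⟩ := hDE l hl
          refine ⟨m, ⟨hm, Val.Allows.coarsens ?_ (hlm.2 x (hlt' l hl))⟩, hlm⟩
          simpa [Ann.complete, hx] using hc

/-- Both premises are played simultaneously. As long as both pivots are needed, their annotations
describe the moves made, and these can be reconciled; when the existential player sets `x`, one
pivot becomes false and the game continues with its premise only. -/
theorem Forces.resolution {x : V} {τ ξ σ : Ann V} (hξσ : ξ.DisjointDom σ)
    (hτ : τ.StarFree) {L : List (Quant × V)}
    (hL : L.Pairwise fun a b => lt a.2 b.2) :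
    ∀ {α : V → Bool} {D₁ D₂ E : AClause V}, Within L D₁ → Within L D₂ →
      Forces M L α D₁ → Forces M L α D₂ →
      (∀ l ∈ D₁, l = ⟨⟨x, true⟩, τ.complete ξ⟩ ∨ ∃ m ∈ E, l.InstOf lt σ m) →
      (∀ l ∈ D₂, l = ⟨⟨x, false⟩, τ.complete σ⟩ ∨ ∃ m ∈ E, l.InstOf lt ξ m) →
      Forces M L α E := by
  induction L with
  | nil => exact fun _ _ h _ _ _ => h
  | cons a L ih =>
    intro α D₁ D₂ E hD₁ hD₂ F₁ F₂ e₁ e₂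
    obtain ⟨hlt, hL'⟩ := List.pairwise_cons.1 hL
    rcases a with ⟨_ | _, y⟩
    · intro v
      by_cases hyx : y = x
      · subst hyx
        -- The value of the pivot variable refutes the pivot of exactly one premise, which is
        -- instantiated and used alone from here on.
        cases v with
        | true =>
          rcases F₂ true with ⟨l, hl, hy⟩ | F₂
          · rcases e₂ l hl with rfl | ⟨m, hm, hlm⟩
            · simp at hy
            · exact Or.inl ⟨m, hm, hlm.1.trans hy⟩
          · refine Or.inr (F₂.inst hL' (τ := ξ) hD₂.tail_ex ?_)
            rintro l ⟨hl, hy⟩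
            rcases e₂ l hl with rfl | ⟨m, hm, hlm⟩
            · simp at hy
            · exact ⟨m, ⟨hm, by rwa [hlm.1]⟩, hlm⟩
        | false =>
          rcases F₁ false with ⟨l, hl, hy⟩ | F₁
          · rcases e₁ l hl with rfl | ⟨m, hm, hlm⟩
            · simp at hy
            · exact Or.inl ⟨m, hm, hlm.1.trans hy⟩
          · refine Or.inr (F₁.inst hL' (τ := σ) hD₁.tail_ex ?_)
            rintro l ⟨hl, hy⟩
            rcases e₁ l hl with rfl | ⟨m, hm, hlm⟩
            · simp at hy
            · exact ⟨m, ⟨hm, by rwa [hlm.1]⟩, hlm⟩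
      · rcases F₁ v with ⟨l, hl, hy⟩ | F₁
        · rcases e₁ l hl with rfl | ⟨m, hm, hlm⟩
          · simp only [Literal.mk.injEq] at hy
            exact absurd hy.1.symm hyx
          · exact Or.inl ⟨m, hm, hlm.1.trans hy⟩
        rcases F₂ v with ⟨l, hl, hy⟩ | F₂
        · rcases e₂ l hl with rfl | ⟨m, hm, hlm⟩
          · simp only [Literal.mk.injEq] at hy
            exact absurd hy.1.symm hyx
          · exact Or.inl ⟨m, hm, hlm.1.trans hy⟩
        refine Or.inr (ih hL' hD₁.tail_ex hD₂.tail_ex F₁ F₂ ?_ ?_)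
        · rintro l ⟨hl, hy⟩
          exact (e₁ l hl).imp_right fun ⟨m, hm, hlm⟩ => ⟨m, ⟨hm, by rwa [hlm.1]⟩, hlm⟩
        · rintro l ⟨hl, hy⟩
          exact (e₂ l hl).imp_right fun ⟨m, hm, hlm⟩ => ⟨m, ⟨hm, by rwa [hlm.1]⟩, hlm⟩
    · have hlt₁ : ∀ l ∈ D₁, lt y l.lit.var := fun l hl => hlt _ (hD₁.tail_all l hl)
      have hlt₂ : ∀ l ∈ D₂, lt y l.lit.var := fun l hl => hlt _ (hD₂.tail_all l hl)
      -- A premise that is forced even without its pivot yields `E` by instantiation alone. Past the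
      -- two case distinctions, both pivots are indispensable.
      by_cases F₁' : Forces M ((Quant.all, y) :: L) α (D₁ \ {⟨⟨x, true⟩, τ.complete ξ⟩})
      · refine F₁'.inst hL (τ := σ) (hD₁.subset Set.sdiff_subset) ?_
        rintro l ⟨hl, hx⟩
        exact (e₁ l hl).resolve_left hx
      by_cases F₂' : Forces M ((Quant.all, y) :: L) α (D₂ \ {⟨⟨x, false⟩, τ.complete σ⟩})
      · refine F₂'.inst hL (τ := ξ) (hD₂.subset Set.sdiff_subset) ?_
        rintro l ⟨hl, hx⟩
        exact (e₂ l hl).resolve_left hx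
      -- An indispensable pivot must survive the move at `y`, so its annotation there fits the move.
      have key : ∀ (D : AClause V) (π : ALit V) (P : Option Val → Prop) (β : V → Bool),
          Forces M L β {l ∈ D | P (l.ann y)} →
          ¬ Forces M L β {l ∈ D \ {π} | P (l.ann y)} → P (π.ann y) := by
        intro D π P β h h'
        by_contra hP
        apply h'
        convert! h using 2
        ext l
        simp only [Set.mem_sdiff, Set.mem_singleton_iff, and_congr_left_iff,
          and_iff_left_iff_imp]
        rintro hl - rfl
        exact hP hl
      have a1 : ∀ c, Forces M L (update α y c) {l ∈ D₁ | Val.Allows c (l.ann y)} →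
          Val.Allows c (τ.complete ξ y) := fun c h =>
        key D₁ ⟨⟨x, true⟩, τ.complete ξ⟩ _ _ h fun h' => F₁' (Or.inl ⟨c, h'⟩)
      have a2 : ∀ c, Forces M L (update α y c) {l ∈ D₂ | Val.Allows c (l.ann y)} →
          Val.Allows c (τ.complete σ y) := fun c h =>
        key D₂ ⟨⟨x, false⟩, τ.complete σ⟩ _ _ h fun h' => F₂' (Or.inl ⟨c, h'⟩)
      have n1 : (∀ c, Forces M L (update α y c) {l ∈ D₁ | l.ann y = none}) →
          τ.complete ξ y = none := fun h => by
        by_contra hn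
        exact F₁' (Or.inr fun c => by_contra fun h' =>
          hn (key D₁ ⟨⟨x, true⟩, τ.complete ξ⟩ (fun a => a = none) _ (h c) h'))
      have n2 : (∀ c, Forces M L (update α y c) {l ∈ D₂ | l.ann y = none}) →
          τ.complete σ y = none := fun h => by
        by_contra hn
        exact F₂' (Or.inr fun c => by_contra fun h' =>
          hn (key D₂ ⟨⟨x, false⟩, τ.complete σ⟩ (fun a => a = none) _ (h c) h'))
      -- every literal is passed on to `E` if the annotations fit
      have step : ∀ (P₁ P₂ P : Option Val → Prop) (c : Bool),
          Forces M L (update α y c) {l ∈ D₁ | P₁ (l.ann y)} →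
          Forces M L (update α y c) {l ∈ D₂ | P₂ (l.ann y)} →
          (∀ a b, P₁ a → Val.Coarsens (a.or (σ y)) b → P b) →
          (∀ a b, P₂ a → Val.Coarsens (a.or (ξ y)) b → P b) →
          Forces M L (update α y c) {l ∈ E | P (l.ann y)} := by
        intro P₁ P₂ P c G₁ G₂ p₁ p₂
        refine ih hL' (hD₁.tail_all.subset fun l hl => hl.1)
          (hD₂.tail_all.subset fun l hl => hl.1) G₁ G₂ ?_ ?_
        · rintro l ⟨hl, hy⟩
          refine (e₁ l hl).imp_right fun ⟨m, hm, hlm⟩ => ⟨m, ⟨hm, ?_⟩, hlm⟩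
          exact p₁ _ _ hy (hlm.2 y (hlt₁ l hl))
        · rintro l ⟨hl, hy⟩
          refine (e₂ l hl).imp_right fun ⟨m, hm, hlm⟩ => ⟨m, ⟨hm, ?_⟩, hlm⟩
          exact p₂ _ _ hy (hlm.2 y (hlt₂ l hl))
      have allow : ∀ (c : Bool) (s a b : Option Val), Val.Allows c a →
          Val.Coarsens (a.or s) b → Val.Allows c b := by
        intro c s a b ha hab
        refine Val.Allows.coarsens ?_ hab
        rcases ha with rfl | rfl <;> simp [Val.Allows]
      have allow' : ∀ (c : Bool) (s a b : Option Val), Val.Allows c s → a = none →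
          Val.Coarsens (a.or s) b → Val.Allows c b := by
        rintro c s a b hs rfl hab
        exact Val.Allows.coarsens (by simpa using hs) hab
      rcases F₁ with ⟨c₁, F₁⟩ | F₁ <;> rcases F₂ with ⟨c₂, F₂⟩ | F₂
      · have b1 := a1 c₁ F₁
        have b2 := a2 c₂ F₂
        -- If both premises commit, both pivots are annotated at `y`. As `ξ` and `σ` are disjoint,
        -- the annotation comes from `τ`, which has no `*` and therefore determines the move.
        have hc : c₁ = c₂ := by
          rcases hv : τ y with _ | t
          · simp only [Ann.complete, hv, Option.none_or] at b1 b2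
            rcases hξσ y with h | h
            · exact absurd h b1.ne_none
            · exact absurd h b2.ne_none
          · have ht : t ≠ Val.star := fun ht => hτ y (by rw [hv, ht])
            simp only [Ann.complete, hv, Option.some_or, Val.Allows, Option.some.injEq, ht,
              or_false] at b1 b2
            rw [b1] at b2
            clear * - b1 b2
            cases c₁ <;> cases c₂ <;> simp [Val.ofBool] at b1 b2 ⊢
        subst hc
        exact Or.inl ⟨c₁, step _ _ _ c₁ F₁ F₂ (allow c₁ _) (allow c₁ _)⟩
      -- Only the first premise commits. The second pivot has no annotation at `y`, so `τ y` is
      -- undefined and the first pivot gets its value from `ξ`. The second premise, indifferent to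
      -- the move, can play `c₁`, and its literals receive `ξ y` by instantiation.
      · have b1 := a1 c₁ F₁
        have b2 := n2 F₂
        simp only [Ann.complete, Option.or_eq_none_iff] at b2
        simp only [Ann.complete, b2.1, Option.none_or] at b1
        exact Or.inl ⟨c₁, step _ _ _ c₁ F₁ (F₂ c₁) (allow c₁ _) fun a b => allow' c₁ _ a b b1⟩
      · have b1 := n1 F₁
        have b2 := a2 c₂ F₂
        simp only [Ann.complete, Option.or_eq_none_iff] at b1
        simp only [Ann.complete, b1.1, Option.none_or] at b2
        exact Or.inl ⟨c₂, step _ _ _ c₂ (F₁ c₂) F₂ (fun a b => allow' c₂ _ a b b2) (allow c₂ _)⟩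
      · have b1 := n1 F₁
        have b2 := n2 F₂
        simp only [Ann.complete, Option.or_eq_none_iff] at b1 b2
        refine Or.inr fun c => step (fun a => a = none) (fun a => a = none) (fun a => a = none) c
          (F₁ c) (F₂ c) ?_ ?_
        · rintro a b rfl hb
          simpa [b2.2, Val.Coarsens] using hb
        · rintro a b rfl hb
          simpa [b1.2, Val.Coarsens] using hb

/-- The player follows `f` and abstains where it is undefined. No universal literal of `C` becomes
true, and an existential one that does is caught by its copy in `D`, whose annotation agrees with
the moves. Otherwise all literals of `C` on the prefix end up false, which is what the hypothesis on
`M` asks for. -/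
theorem Forces.axiom_clause (hirr : ∀ x, ¬ lt x x) {C : Finset (Literal V)} {f : Ann V}
    (hf : ∀ u v, f u = some (Val.ofBool v) → (⟨u, v⟩ : Literal V) ∉ C) {L : List (Quant × V)}
    (hL : L.Pairwise fun a b => lt a.2 b.2)
    (hfL : ∀ u, (Quant.all, u) ∈ L → ∀ v, (⟨u, v⟩ : Literal V) ∈ C →
      ∃ c, f u = some (Val.ofBool c)) :
    ∀ {α : V → Bool} {D : AClause V},
      (∀ β : V → Bool, (∀ x ∉ L.map Prod.snd, β x = α x) →
        (∀ l ∈ C, l.var ∈ L.map Prod.snd → β l.var ≠ l.pos) → M β) →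
      (∀ l ∈ C, (Quant.ex, l.var) ∈ L → ∃ m ∈ D, m.lit = l ∧ ∀ u, lt u l.var → m.ann u = f u) →
      Forces M L α D := by
  induction L with
  | nil => exact fun h _ => h _ (fun _ _ => rfl) (by simp)
  | cons a L ih =>
    intro α D hM hD
    obtain ⟨hlt, hL'⟩ := List.pairwise_cons.1 hL
    have ih := @ih hL' fun u hu => hfL u (List.mem_cons_of_mem _ hu)
    have hM' : ∀ v, (⟨a.2, v⟩ : Literal V) ∉ C → ∀ β : V → Bool,
        (∀ x ∉ L.map Prod.snd, β x = update α a.2 v x) →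
        (∀ l ∈ C, l.var ∈ L.map Prod.snd → β l.var ≠ l.pos) → M β := by
      intro v hv β hβ hC
      refine hM β (fun x hx => ?_) fun l hl hx => ?_
      · simp only [List.map_cons, List.mem_cons, not_or] at hx
        rw [hβ x hx.2, update_of_ne hx.1]
      · by_cases hx' : l.var ∈ L.map Prod.snd
        · exact hC l hl hx'
        · have : l.var = a.2 := by simpa [hx'] using hx
          rw [hβ _ hx', this, update_self]
          rintro rfl
          exact hv (this ▸ hl)
    rcases a with ⟨_ | _, y⟩
    · intro v
      by_cases hv : (⟨y, v⟩ : Literal V) ∈ C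
      · obtain ⟨m, hm, h, -⟩ := hD _ hv (by simp)
        exact Or.inl ⟨m, hm, h⟩
      · refine Or.inr (ih (hM' v hv) fun l hl hx => ?_)
        obtain ⟨m, hm, h, h'⟩ := hD l hl (List.mem_cons_of_mem _ hx)
        refine ⟨m, ⟨hm, ?_⟩, h, h'⟩
        rintro rfl
        exact hirr _ (h ▸ hlt _ hx)
    · by_cases hy : f y = none
      · have hv : ∀ v, (⟨y, v⟩ : Literal V) ∉ C := fun v hv => by
          obtain ⟨c, hc⟩ := hfL y (by simp) v hv
          simp [hy] at hc
        refine Or.inr fun c => ih (hM' c (hv c)) fun l hl hx => ?_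
        obtain ⟨m, hm, h, h'⟩ := hD l hl (List.mem_cons_of_mem _ hx)
        exact ⟨m, ⟨hm, (h' y (hlt _ hx)).trans hy⟩, h, h'⟩
      · obtain ⟨c, hc⟩ := Val.exists_allows hy
        have hv : (⟨y, c⟩ : Literal V) ∉ C := fun hv => by
          obtain ⟨d, hd⟩ := hfL y (by simp) c hv
          have : d = c := by
            rw [hd] at hc
            clear * - hc
            cases c <;> cases d <;> simp [Val.Allows, Val.ofBool] at hc ⊢
          exact hf y d hd (this ▸ hv)
        refine Or.inl ⟨c, ih (hM' c hv) fun l hl hx => ?_⟩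
        obtain ⟨m, hm, h, h'⟩ := hD l hl (List.mem_cons_of_mem _ hx)
        exact ⟨m, ⟨hm, by rw [h' y (hlt _ hx)]; exact hc⟩, h, h'⟩

end Game

/-! ### The two halves of `F^b` -/

theorem QBF.pre_pairwise {V : Type} [DecidableEq V] (F : QBF V) :
    F.pre.Pairwise fun a b => F.ind a.2 < F.ind b.2 := by
  have h : F.vars.Pairwise fun a b => F.ind a < F.ind b := by
    rw [List.pairwise_iff_getElem]
    intro i j hi hj hij
    rwa [QBF.ind, QBF.ind, F.nodup.idxOf_getElem, F.nodup.idxOf_getElem]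
  simpa [QBF.vars, List.pairwise_map] using h

/-- Identifies the remaining prefix after a variable when a strategy has only been given that some
such suffix exists. -/
theorem suffix_cons_unique {α : Type} {a : α} {l m₁ m₂ : List α} (hl : l.Nodup)
    (h₁ : a :: m₁ <:+ l) (h₂ : a :: m₂ <:+ l) : m₁ = m₂ := by
  have key : ∀ {m₁ m₂ : List α}, a :: m₁ <:+ l → a :: m₂ <:+ l → a :: m₁ <:+ a :: m₂ →
      m₁ = m₂ := by
    intro m₁ m₂ _ h₂ h
    rcases List.suffix_cons_iff.1 h with h | h
    · simpa using h
    · exact absurd (h.subset (by simp)) (List.nodup_cons.1 (hl.sublist h₂.sublist)).1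
  rcases List.suffix_or_suffix_of_suffix h₁ h₂ with h | h
  · exact key h₁ h₂ h
  · exact (key h₂ h₁ h).symm

/-! ### Positions and plays of the game -/

section

variable {V : Type} [DecidableEq V] {M : (V → Bool) → Prop}

open Function

/-- Values on `L` are overwritten during the game, and `M` sees only `S`. A strategy that knows only
the earlier variables can thus evaluate positions correctly. -/
theorem Forces.congr {S : Set V} (hM : ∀ α β : V → Bool, (∀ x ∈ S, α x = β x) → M α → M β)
    {L : List (Quant × V)} : ∀ {α β : V → Bool} {D : AClause V},
      (∀ x ∈ S, x ∉ L.map Prod.snd → α x = β x) → Forces M L α D → Forces M L β D := by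
  induction L with
  | nil => exact fun h => hM _ _ (by simpa using h)
  | cons a L ih =>
    intro α β D h
    have h' : ∀ v, ∀ x ∈ S, x ∉ L.map Prod.snd → update α a.2 v x = update β a.2 v x := by
      intro v x hx hxL
      by_cases hxa : x = a.2
      · simp [hxa]
      · rw [update_of_ne hxa, update_of_ne hxa]
        exact h x hx (by simpa [hxa] using hxL)
    rcases a with ⟨_ | _, y⟩
    · exact fun H v => (H v).imp_right (ih (h' v))
    · exact Or.imp (fun ⟨c, H⟩ => ⟨c, ih (h' c) H⟩) fun H c => ih (h' c) (H c)

theorem Forces.exists_move {u : V} {L : List (Quant × V)} {α : V → Bool}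
    (h : Forces M ((Quant.all, u) :: L) α ∅) : ∃ c, Forces M L (update α u c) ∅ := by
  rcases h with ⟨c, h⟩ | h
  · exact ⟨c, by simpa using h⟩
  · exact ⟨false, by simpa using h false⟩

/-- Here `α` is the final assignment of a play, so every move writes the value already present and
the position never changes. With the empty clause, the escape at existential variables is
impossible. -/
theorem Forces.of_play {L : List (Quant × V)} {α : V → Bool} (h : Forces M L α ∅)
    (hα : ∀ u L', (Quant.all, u) :: L' <:+ L → Forces M ((Quant.all, u) :: L') α ∅ →
      Forces M L' α ∅) : M α := by
  induction L with
  | nil => exact h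
  | cons a L ih =>
    refine ih ?_ fun u L' hs => hα u L' (hs.trans (List.suffix_cons _ _))
    rcases a with ⟨_ | _, y⟩
    · simpa using h (α y)
    · exact hα y L (List.suffix_refl _) h

end

/-! ### From the game on one half to a strategy for the whole formula -/

namespace Setting

variable (F : Setting)

/-- The variables of `q` and those of `r`, with their quantifiers. -/
def side : Bool → List (Quant × Name)
  | false => (List.range F.nQ).map fun i => (F.quQ i, Name.q i)
  | true => (List.range F.nR).map fun i => (F.quR i, Name.r i)

def cnf : Bool → CNF Name
  | false => F.A
  | true => F.B

/-- `A` or `B` is false under `α`. -/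
def Falsified (g : Bool) (α : Name → Bool) : Prop := ∃ C ∈ F.cnf g, ∀ l ∈ C, α l.var ≠ l.pos

theorem side_sublist (g : Bool) : (F.side g).Sublist F.withB.pre := by
  refine List.Sublist.trans ?_ (List.sublist_append_right _ _)
  refine List.Sublist.trans ?_ (List.sublist_cons_self _ _)
  cases g
  · exact List.sublist_append_left _ _
  · exact List.sublist_append_right _ _

theorem side_pairwise (g : Bool) :
    (F.side g).Pairwise fun a b => F.withB.ind a.2 < F.withB.ind b.2 :=
  F.withB.pre_pairwise.sublist (F.side_sublist g)

theorem side_nodup (g : Bool) : (F.side g).Nodup :=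
  List.Nodup.of_map _ (F.withB.nodup.sublist ((F.side_sublist g).map _))

theorem ind_p_lt {i : ℕ} (hi : i < F.nP) {x : Quant × Name}
    (hx : x = (Quant.all, Name.b) ∨ ∃ g, x ∈ F.side g) :
    F.withB.ind (Name.p i) < F.withB.ind x.2 := by
  have h := (List.pairwise_append.1 (show List.Pairwise _ (_ ++ _) from F.withB.pre_pairwise)).2.2
  refine h (Quant.ex, Name.p i) (by simp [hi]) x ?_
  rcases hx with rfl | ⟨_ | _, hx⟩
  · simp
  · exact List.mem_cons_of_mem _ (List.mem_append_left _ hx)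
  · exact List.mem_cons_of_mem _ (List.mem_append_right _ hx)

theorem ind_b_lt {g : Bool} {x : Quant × Name} (hx : x ∈ F.side g) :
    F.withB.ind Name.b < F.withB.ind x.2 := by
  have h := (List.pairwise_append.1 (show List.Pairwise _ (_ ++ _) from F.withB.pre_pairwise)).2.1
  refine (List.pairwise_cons.1 h).1 x ?_
  cases g
  · exact List.mem_append_left _ hx
  · exact List.mem_append_right _ hx

theorem mem_vars_of_mem_side {g : Bool} {x : Quant × Name} (hx : x ∈ F.side g) :
    x.2 ∈ F.withB.vars := List.mem_map_of_mem ((F.side_sublist g).subset hx)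

theorem p_mem_vars {i : ℕ} (hi : i < F.nP) : Name.p i ∈ F.withB.vars := by
  simp [QBF.vars, withB, preB, hi]

theorem cnf_vars {g : Bool} {C : Finset (Literal Name)} (hC : C ∈ F.cnf g) {l : Literal Name}
    (hl : l ∈ C) : (∃ i < F.nP, l.var = Name.p i) ∨ l.var ∈ (F.side g).map Prod.snd := by
  cases g
  · exact (F.A_vars C hC l hl).imp_right fun ⟨i, hi, h⟩ => by simp [side, h, hi]
  · exact (F.B_vars C hC l hl).imp_right fun ⟨i, hi, h⟩ => by simp [side, h, hi]

/-- The variables on which `A` and `B` depend. -/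
def support (g : Bool) : Set Name :=
  {x | (∃ i < F.nP, x = Name.p i) ∨ x ∈ (F.side g).map Prod.snd}

theorem Falsified.congr {g : Bool} (α β : Name → Bool) (h : ∀ x ∈ F.support g, α x = β x) :
    F.Falsified g α → F.Falsified g β := fun ⟨C, hC, hα⟩ =>
  ⟨C, hC, fun l hl => by rw [← h _ (F.cnf_vars hC hl)]; exact hα l hl⟩

theorem insert_b_mem_matrixB {g : Bool} {C : Finset (Literal Name)} (hC : C ∈ F.cnf g) :
    insert ⟨Name.b, !g⟩ C ∈ F.withB.matrix := by
  cases g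
  · exact Finset.mem_union_left _ (Finset.mem_image_of_mem _ hC)
  · exact Finset.mem_union_right _ (Finset.mem_image_of_mem _ hC)

open Function in
/-- If for every assignment to `p` the player can win the game on one of the halves, then it is a
winning strategy to choose this half with `b` and to play the game on it. -/
theorem exists_winning (g : (Name → Bool) → Bool)
    (hg : ∀ α β : Name → Bool, (∀ i < F.nP, α (Name.p i) = β (Name.p i)) → g α = g β)
    (hw : ∀ α, Forces (F.Falsified (g α)) (F.side (g α)) α ∅) :
    ∃ S : F.withB.UnivStrategy, F.withB.IsWinning S ∧
      ∀ α : Name → Bool, g α = S Name.b F.univ_b (fun x => α x.1) := by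
  classical
  -- Unknown variables are set to `false`; these junk values lie in the unplayed part of the prefix
  -- or outside the support of the chosen half, so they have no effect.
  let ext (u : Name) (ρ : F.withB.Before u → Bool) : Name → Bool := fun x =>
    if h : x ∈ F.withB.vars ∧ F.withB.ind x < F.withB.ind u then ρ ⟨x, h⟩ else false
  let good (u : Name) (α : Name → Bool) (c : Bool) : Prop :=
    ∃ L, (Quant.all, u) :: L <:+ F.side (α Name.b) ∧
      Forces (F.Falsified (α Name.b)) L (update α u c) ∅
  let S : F.withB.UnivStrategy := fun u _ ρ =>
    if u = Name.b then g (ext u ρ)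
    else if h : ∃ c, good u (ext u ρ) c then h.choose else false
  have hext : ∀ (u : Name) (α : Name → Bool) (x : Name), x ∈ F.withB.vars →
      F.withB.ind x < F.withB.ind u → ext u (fun x => α x.1) x = α x := by
    intro u α x hx hxu
    exact dif_pos ⟨hx, hxu⟩
  have hSb : ∀ α : Name → Bool, g α = S Name.b F.univ_b (fun x => α x.1) := by
    intro α
    simp only [S, if_true]
    exact hg _ _ fun i hi =>
      (hext _ _ _ (F.p_mem_vars hi) (F.ind_p_lt hi (x := (Quant.all, Name.b)) (Or.inl rfl))).symm
  refine ⟨S, fun α hα => ?_, hSb⟩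
  have hb : g α = α Name.b := (hSb α).trans (hα _ F.univ_b).symm
  have hF : F.Falsified (α Name.b) α := by
    rw [← hb]
    refine (hw α).of_play fun u L hL hu => ?_
    have hmem : (Quant.all, u) ∈ F.side (g α) := hL.subset (by simp)
    set β := ext u (fun x => α x.1) with hβ
    have hβb : β Name.b = g α := by
      rw [hβ, hext _ _ _ _ (F.ind_b_lt hmem), hb]
      exact List.mem_map_of_mem F.univ_b
    -- A variable of the support that is not still to be played, and is not `u` itself, precedes
    -- `u`, and is therefore visible to the strategy.
    have agree : ∀ c, ∀ x ∈ F.support (g α), x ∉ L.map Prod.snd →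
        update α u c x = update β u c x := by
      intro c x hx hxL
      by_cases hxu : x = u
      · simp [hxu]
      rw [update_of_ne hxu, update_of_ne hxu]
      refine (hext u α x ?_ ?_).symm
      · rcases hx with ⟨i, hi, rfl⟩ | hx
        · exact F.p_mem_vars hi
        · obtain ⟨y, hy, rfl⟩ := List.mem_map.1 hx
          exact F.mem_vars_of_mem_side hy
      · rcases hx with ⟨i, hi, rfl⟩ | hx
        · exact F.ind_p_lt hi (x := (Quant.all, u)) (Or.inr ⟨_, hmem⟩)
        · obtain ⟨y, hy, rfl⟩ := List.mem_map.1 hx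
          obtain ⟨K, hK⟩ := hL
          have hp := F.side_pairwise (g α)
          rw [← hK] at hp hy
          rcases List.mem_append.1 hy with hy | hy
          · exact (List.pairwise_append.1 hp).2.2 y hy (Quant.all, u) (by simp)
          · rcases List.mem_cons.1 hy with rfl | hy
            · exact absurd rfl hxu
            · exact absurd (List.mem_map_of_mem hy) hxL
    have hex : ∃ c, good u β c := by
      obtain ⟨c, hc⟩ := hu.exists_move
      refine ⟨c, L, by rwa [hβb], ?_⟩
      rw [hβb]
      exact Forces.congr (Falsified.congr F) (agree c) hc
    have hub : u ≠ Name.b := by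
      rintro rfl
      exact lt_irrefl _ (F.ind_b_lt hmem)
    have hαu : α u = hex.choose := by
      rw [hα u ((F.side_sublist _).subset hmem)]
      simp only [S, if_neg hub]
      rw [dif_pos hex]
    obtain ⟨L', hL', hc⟩ := hex.choose_spec
    rw [hβb] at hL' hc
    -- The chosen move was good for some suffix after `u`; it has to be the one of the current play.
    rw [suffix_cons_unique (F.side_nodup _) hL' hL, ← hαu] at hc
    have := Forces.congr (Falsified.congr F) (fun x hx hxL => (agree (α u) x hx hxL).symm) hc
    simpa using this
  obtain ⟨C, hC, hCα⟩ := hF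
  intro hM
  obtain ⟨l, hl, h⟩ := hM _ (F.insert_b_mem_matrixB hC)
  -- The literal on `b` in the clauses of the chosen half has sign `!g`, so setting `b` to `g` makes
  -- it false as well.
  rcases Finset.mem_insert.1 hl with rfl | hl
  · simp at h
  · exact hCα l hl h

end Setting

/-! ### The interpolating circuit -/

/-- The sign of the last literal on the variable `b`. -/
def axFlag : Bool → List (Literal Name) → Bool
  | v, [] => v
  | v, l :: C => axFlag (if l.var = Name.b then l.pos else v) C

/-- The three ways to combine the values of the premises of a resolution step. -/
inductive Kind
  | mux
  | disj
  | conj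
  deriving DecidableEq

instance : Fintype Kind := ⟨{.mux, .disj, .conj}, fun c => by cases c <;> simp⟩

/-- The case of `b` is irrelevant: `b` is universal and never a pivot in a valid proof. -/
def Name.kind : Name → Kind
  | .p _ => .mux
  | .q _ => .disj
  | _ => .conj

def Rule.kind : Rule Name → Kind
  | .res _ _ x => x.kind
  | _ => .conj

def pivotGate : Name → Gate
  | .p m => Gate.input m
  | _ => Gate.const false

/-- The gates that depend on the premises. The output of line `i` is gate `16 * i + 15`, gate `0`
is always false. -/
def headGates : Rule Name → List Gate
  | .ax C => [Gate.const !axFlag false C, Gate.const !axFlag false C, Gate.const false]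
  | .inst i => [Gate.or (16 * i + 15) 0, Gate.const true, Gate.const false]
  | .merge i => [Gate.or (16 * i + 15) 0, Gate.const true, Gate.const false]
  | .res i j x => [Gate.or (16 * i + 15) 0, Gate.or (16 * j + 15) 0, pivotGate x]

/-- In a block, gates 8 and 9 carry the premise bits g₁, g₂ and gate 10 the pivot. The output is (g₁
∨ s₁) ∧ (g₂ ∨ s₂) for the selectors s₁, s₂: the pivot and its negation give the selection, g₂ and g₁
give ∨, and 0, 0 give ∧. Rules other than resolution pass a value through by the last form. -/
def selGate₁ (k : ℕ) : Kind → Gate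
  | .mux => Gate.or (16 * k + 10) 0
  | .disj => Gate.or (16 * k + 9) 0
  | .conj => Gate.and (16 * k + 10) 0

/-- In the monotone circuit the negated pivot is replaced by 0, obtained as a conjunction with gate
0. -/
def selGate₂ (mono : Bool) (k : ℕ) : Kind → Gate
  | .mux => if mono then Gate.and (16 * k + 10) 0 else Gate.not (16 * k + 10)
  | .disj => Gate.or (16 * k + 8) 0
  | .conj => Gate.and (16 * k + 10) 0

def tailGates (mono : Bool) (k : ℕ) (c : Kind) : List Gate :=
  [selGate₁ k c, selGate₂ mono k c, Gate.or (16 * k + 8) (16 * k + 11),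
    Gate.or (16 * k + 9) (16 * k + 12), Gate.and (16 * k + 13) (16 * k + 14)]

/-- The sixteen gates of line `k`. The first eight of them make the binary representations of the
positions of the others start with the same digit. -/
def block (mono : Bool) (k : ℕ) (R : Rule Name) : List Gate :=
  List.replicate 8 (Gate.const false) ++ (headGates R ++ tailGates mono k R.kind)

def blocks (mono : Bool) : ℕ → Proof Name → Circuit
  | _, [] => []
  | k, ln :: π => block mono k ln.rule ++ blocks mono (k + 1) π

/-- The circuit extracted from a proof. -/
def extract (mono : Bool) (π : Proof Name) : Circuit := blocks mono 0 π

theorem length_block (mono : Bool) (k : ℕ) (R : Rule Name) : (block mono k R).length = 16 := by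
  cases R <;> rfl

theorem blocks_append (mono : Bool) (π π' : Proof Name) (k : ℕ) :
    blocks mono k (π ++ π') = blocks mono k π ++ blocks mono (k + π.length) π' := by
  induction π generalizing k with
  | nil => rfl
  | cons ln π ih => simp [blocks, ih, Nat.add_assoc, Nat.add_comm 1]

theorem length_blocks (mono : Bool) (π : Proof Name) (k : ℕ) :
    (blocks mono k π).length = 16 * π.length := by
  induction π generalizing k with
  | nil => rfl
  | cons ln π ih => simp [blocks, ih, length_block]; omega

/-! #### Evaluation -/

section Eval

/-- The values of further gates are appended to those of the gates before them. -/
def evalFrom (a : ℕ → Bool) (vals : List Bool) (gs : List Gate) : List Bool :=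
  gs.foldl (fun vals g => vals ++ [g.eval a vals]) vals

theorem evalFrom_eq_append (a : ℕ → Bool) (gs : List Gate) (vals : List Bool) :
    ∃ l, evalFrom a vals gs = vals ++ l ∧ l.length = gs.length := by
  induction gs generalizing vals with
  | nil => exact ⟨[], by simp [evalFrom], rfl⟩
  | cons g gs ih =>
    obtain ⟨l, h, hl⟩ := ih (vals ++ [g.eval a vals])
    exact ⟨g.eval a vals :: l, by simpa [evalFrom] using h, by simp [hl]⟩

theorem evalFrom_getD (a : ℕ → Bool) (gs : List Gate) (vals : List Bool) {n : ℕ}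
    (hn : n < vals.length) : (evalFrom a vals gs).getD n false = vals.getD n false := by
  obtain ⟨l, h, -⟩ := evalFrom_eq_append a gs vals
  rw [h, List.getD_append _ _ _ _ hn]

theorem Circuit.values_append (C D : Circuit) (a : ℕ → Bool) :
    Circuit.values (C ++ D) a = evalFrom a (C.values a) D := List.foldl_append

theorem Circuit.length_values (C : Circuit) (a : ℕ → Bool) : (C.values a).length = C.length := by
  obtain ⟨l, h, hl⟩ := evalFrom_eq_append a C []
  rw [List.nil_append] at h
  exact (congrArg List.length h).trans hl

/-- The value of a resolvent. -/
def resVal (mono : Bool) (a : ℕ → Bool) : Name → Bool → Bool → Bool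
  | .p m, g₁, g₂ => (g₁ || a m) && (g₂ || !mono && !a m)
  | .q _, g₁, g₂ => g₁ || g₂
  | _, g₁, g₂ => g₁ && g₂

def ruleVal (mono : Bool) (a : ℕ → Bool) (v : ℕ → Bool) : Rule Name → Bool
  | .ax C => !axFlag false C
  | .inst i => v i
  | .merge i => v i
  | .res i j x => resVal mono a x (v i) (v j)

def Rule.premises : Rule Name → List ℕ
  | .ax _ => []
  | .inst i => [i]
  | .merge i => [i]
  | .res i j _ => [i, j]

theorem block_getD_zero (mono : Bool) (k : ℕ) (R : Rule Name) (a : ℕ → Bool) :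
    (evalFrom a [] (block mono k R)).getD 0 false = false := by
  simp only [block, List.replicate, List.cons_append, evalFrom, List.foldl_cons]
  exact evalFrom_getD a _ _ (by simp)

theorem evalFrom_block (mono : Bool) {k : ℕ} {R : Rule Name} (a : ℕ → Bool) {vals : List Bool}
    (hk : vals.length = 16 * k) (h0 : vals.getD 0 false = false)
    (hR : ∀ i ∈ R.premises, i < k) :
    (evalFrom a vals (block mono k R)).getD (16 * k + 15) false =
      ruleVal mono a (fun i => vals.getD (16 * i + 15) false) R := by
  set w := vals ++ List.replicate 8 false with hw
  have hwl : w.length = 16 * k + 8 := by simp [hw, hk]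
  have hold : ∀ l n, n < 16 * k → (w ++ l).getD n false = vals.getD n false := by
    intro l n hn
    rw [hw, List.append_assoc, List.getD_append _ _ _ _ (by omega)]
  have hzero : ∀ l, (w ++ l).getD 0 false = false := by
    intro l
    -- In the first block, gate 0 belongs to the padding just written; later it is an old gate.
    rcases Nat.eq_zero_or_pos k with rfl | hk'
    · have : vals = [] := List.length_eq_zero_iff.1 (by simpa using hk)
      simp [hw, this, List.replicate]
    · rw [hold _ _ (by omega), h0]
  have hnew : ∀ l o, (w ++ l).getD (16 * k + 8 + o) false = l.getD o false := by
    intro l o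
    rw [List.getD_append_right _ _ _ _ (by omega)]
    congr 1
    omega
  have h8 := fun l => hnew l 0
  have h9 := fun l => hnew l 1
  have h10 := fun l => hnew l 2
  have h11 := fun l => hnew l 3
  have h12 := fun l => hnew l 4
  have h13 := fun l => hnew l 5
  have h14 := fun l => hnew l 6
  have h15 := fun l => hnew l 7
  simp only [Nat.add_assoc, Nat.reduceAdd] at h8 h9 h10 h11 h12 h13 h14 h15
  have hstart : evalFrom a vals (block mono k R) =
      evalFrom a w (headGates R ++ tailGates mono k R.kind) := by
    rw [block, evalFrom, List.foldl_append]
    congr 1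
    simp [hw, List.replicate, Gate.eval]
  rw [hstart]
  rcases R with C | i | i | ⟨i, j, _ | _ | _ | _⟩
  all_goals
    simp only [Rule.premises, List.mem_cons, List.not_mem_nil, or_false, forall_eq_or_imp,
      forall_eq] at hR
  all_goals
    simp only [headGates, tailGates, Rule.kind, Name.kind, pivotGate, selGate₁, selGate₂,
      evalFrom, List.cons_append, List.nil_append, List.foldl_cons, List.foldl_nil]
  all_goals
    have hzero' : w.getD 0 false = false := by simpa using hzero []
    have hold' : ∀ n < 16 * k, w.getD n false = vals.getD n false := by simpa using hold []
  all_goals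
    cases mono
  all_goals
    simp only [List.append_assoc, List.cons_append, List.nil_append, Gate.eval, h15, h14, h13,
      h12, h11, h10, h9, h8, hzero, hzero', List.getD_cons_succ, List.getD_cons_zero, ruleVal,
      resVal, Bool.or_false, Bool.and_false, Bool.and_true, Bool.and_self,
      Bool.false_eq_true, if_false, if_true, Bool.not_true, Bool.not_false, Bool.true_and,
      Bool.false_and]
  all_goals
    try rw [hold' (16 * i + 15) (by omega)]
  all_goals
    try rw [hold _ (16 * j + 15) (by omega)]
  all_goals
    try simp only [Bool.and_self, Bool.or_comm]

end Eval

/-! ### Correctness of the circuit -/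

/-- Each gate reads only gates before it, if the first gate of the list has position `n`. -/
def WellFormedFrom : ℕ → List Gate → Prop
  | _, [] => True
  | n, g :: gs => (∀ j ∈ g.preds, j < n) ∧ WellFormedFrom (n + 1) gs

theorem WellFormedFrom.append {gs hs : List Gate} {n : ℕ} (h : WellFormedFrom n gs)
    (h' : WellFormedFrom (n + gs.length) hs) : WellFormedFrom n (gs ++ hs) := by
  induction gs generalizing n with
  | nil => exact h'
  | cons g gs ih =>
    exact ⟨h.1, ih h.2 (by rwa [List.length_cons, Nat.add_comm gs.length, ← Nat.add_assoc] at h')⟩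

theorem WellFormedFrom.getElem {gs : List Gate} {n : ℕ} (h : WellFormedFrom n gs) (k : ℕ)
    (hk : k < gs.length) : ∀ j ∈ gs[k].preds, j < n + k := by
  induction gs generalizing n k with
  | nil => simp at hk
  | cons g gs ih =>
    cases k with
    | zero => exact h.1
    | succ k =>
      intro j hj
      have := ih h.2 k (by simpa using hk) j (by simpa using hj)
      omega

theorem wellFormedFrom_block (mono : Bool) {k : ℕ} {R : Rule Name}
    (hR : ∀ i ∈ R.premises, i < k) : WellFormedFrom (16 * k) (block mono k R) := by
  rcases R with C | i | i | ⟨i, j, x⟩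
  all_goals
    simp only [Rule.premises, List.mem_cons, List.not_mem_nil, or_false, forall_eq_or_imp,
      forall_eq] at hR
  all_goals
    try cases x
  all_goals
    cases mono <;>
    simp [block, List.replicate, headGates, tailGates, Rule.kind, Name.kind, pivotGate, selGate₁,
      selGate₂, WellFormedFrom, Gate.preds] <;> omega

theorem wellFormedFrom_blocks (mono : Bool) {π : Proof Name} {k : ℕ}
    (hπ : ∀ (i : ℕ) (hi : i < π.length), ∀ j ∈ π[i].rule.premises, j < k + i) :
    WellFormedFrom (16 * k) (blocks mono k π) := by
  induction π generalizing k with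
  | nil => trivial
  | cons ln π ih =>
    refine (wellFormedFrom_block mono (hπ 0 (by simp))).append ?_
    rw [length_block]
    refine ih (k := k + 1) fun i hi j hj => ?_
    have := hπ (i + 1) (by simpa using hi) j (by simpa using hj)
    omega

theorem mem_blocks {mono : Bool} {π : Proof Name} {k : ℕ} {g : Gate} (h : g ∈ blocks mono k π) :
    ∃ ln ∈ π, ∃ k', g ∈ block mono k' ln.rule := by
  induction π generalizing k with
  | nil => simp [blocks] at h
  | cons ln π ih =>
    rcases List.mem_append.1 h with h | h
    · exact ⟨ln, by simp, k, h⟩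
    · obtain ⟨ln', h', h''⟩ := ih h
      exact ⟨ln', List.mem_cons_of_mem _ h', h''⟩

theorem input_mem_block {mono : Bool} {k m : ℕ} {R : Rule Name}
    (h : Gate.input m ∈ block mono k R) : ∃ i j, R = .res i j (.p m) := by
  rcases R with C | i | i | ⟨i, j, x⟩
  all_goals
    try cases x
  all_goals
    cases mono <;>
    simp [block, headGates, tailGates, Rule.kind, Name.kind, pivotGate, selGate₁, selGate₂] at h ⊢
  all_goals exact h.symm

theorem monotone_extract (π : Proof Name) : (extract true π).Monotone := by
  intro j hj
  obtain ⟨ln, -, k, h⟩ := mem_blocks hj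
  rcases hR : ln.rule with C | i | i | ⟨i, j, x⟩ <;> rw [hR] at h
  all_goals
    try cases x
  all_goals
    simp [block, headGates, tailGates, Rule.kind, Name.kind, pivotGate, selGate₁, selGate₂] at h

theorem evalFrom_congr {a b : ℕ → Bool} {gs : List Gate}
    (h : ∀ i, Gate.input i ∈ gs → a i = b i) (vals : List Bool) :
    evalFrom a vals gs = evalFrom b vals gs := by
  induction gs generalizing vals with
  | nil => rfl
  | cons g gs ih =>
    have hg : g.eval a vals = g.eval b vals := by
      cases g <;> simp [Gate.eval] at h ⊢
      exact h.1
    simp only [evalFrom, List.foldl_cons, hg]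
    exact ih (fun i hi => h i (List.mem_cons_of_mem _ hi)) _

/-- The value of line `k`. -/
def lineVal (mono : Bool) (π : Proof Name) (a : ℕ → Bool) (k : ℕ) : Bool :=
  ((extract mono π).values a).getD (16 * k + 15) false

/-- The proof is cut around line `k`. Later blocks only append values, so the values of the block
and of its premises are the final ones. -/
theorem lineVal_eq (mono : Bool) (π : Proof Name) (a : ℕ → Bool) {k : ℕ} (hk : k < π.length)
    (hR : ∀ i ∈ π[k].rule.premises, i < k) :
    lineVal mono π a k = ruleVal mono a (lineVal mono π a) π[k].rule := by
  have hlen : (π.take k).length = k := by simp; omega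
  set vals := (blocks mono 0 (π.take k)).values a with hvals
  have hvl : vals.length = 16 * k := by
    rw [hvals, Circuit.length_values, length_blocks, hlen]
  have hπ : (extract mono π).values a = evalFrom a (evalFrom a vals (block mono k π[k].rule))
      (blocks mono (k + 1) (π.drop (k + 1))) := by
    conv_lhs => rw [extract, ← List.take_append_drop k π, List.drop_eq_getElem_cons hk]
    rw [blocks_append, Circuit.values_append, hlen, Nat.zero_add, blocks, evalFrom,
      List.foldl_append]
    rfl
  have hlen' : (evalFrom a vals (block mono k π[k].rule)).length = 16 * k + 16 := by
    obtain ⟨l, h, hl⟩ := evalFrom_eq_append a (block mono k π[k].rule) vals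
    rw [h, List.length_append, hvl, hl, length_block]
  have hold : ∀ i < k, lineVal mono π a i = vals.getD (16 * i + 15) false := by
    intro i hi
    rw [lineVal, hπ, evalFrom_getD _ _ _ (by omega), evalFrom_getD _ _ _ (by omega)]
  have h0 : vals.getD 0 false = false := by
    rcases hπ' : π.take k with _ | ⟨ln, π'⟩
    · rw [hvals, hπ']
      rfl
    · rw [hvals, hπ', blocks, Circuit.values_append]
      have hb : (Circuit.values (block mono 0 ln.rule) a).length = 16 := by
        rw [Circuit.length_values, length_block]
      rw [evalFrom_getD _ _ _ (by omega)]
      exact block_getD_zero mono 0 ln.rule a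
  rw [lineVal, hπ, evalFrom_getD _ _ _ (by omega), evalFrom_block mono a hvl h0 hR]
  rcases hr : π[k].rule with C | i | i | ⟨i, j, x⟩ <;> rw [hr] at hR
  · rfl
  · exact (hold i (hR i (by simp [Rule.premises]))).symm
  · exact (hold i (hR i (by simp [Rule.premises]))).symm
  · simp only [ruleVal]
    rw [hold i (hR i (by simp [Rule.premises])), hold j (hR j (by simp [Rule.premises]))]

theorem eval_extract (mono : Bool) {π : Proof Name} (hπ : π ≠ []) (a : ℕ → Bool) :
    (extract mono π).eval a = lineVal mono π a (π.length - 1) := by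
  have hpos : 0 < π.length := List.length_pos_iff.2 hπ
  have hl : ((extract mono π).values a).length = 16 * π.length := by
    rw [Circuit.length_values, extract, length_blocks]
  rw [Circuit.eval, lineVal, List.getLastD_eq_getLast?, List.getLast?_eq_getElem?, hl,
    List.getD_eq_getElem?_getD]
  congr 2
  omega

/-! #### The meaning of the lines -/

namespace Setting

variable (F : Setting)

theorem isEx_iff (x : Name) :
    F.withB.IsEx x ↔ (∃ i < F.nP, x = Name.p i) ∨ ∃ g, (Quant.ex, x) ∈ F.side g := by
  simp only [QBF.IsEx, withB, preB, side, List.mem_append, List.mem_cons, List.mem_map,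
    List.mem_range, Bool.exists_bool, Prod.mk.injEq, reduceCtorEq, false_and, true_and, false_or]
  exact or_congr_left ⟨fun ⟨i, h, h'⟩ => ⟨i, h, h'.symm⟩, fun ⟨i, h, h'⟩ => ⟨i, h, h'.symm⟩⟩

/-- Every literal of `D` is existential. -/
def AllEx (D : AClause Name) : Prop := ∀ l ∈ D, F.withB.IsEx l.lit.var

/-- A literal on a variable in `p` that is true under `α` and, unless `g` is `1`, positive in the
monotone case. -/
def TrueP (mono : Bool) (α : Name → Bool) (g : Bool) (l : Literal Name) : Prop :=
  (∃ i, l.var = Name.p i) ∧ α l.var = l.pos ∧ (g = false → mono = true → l.pos = true)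

/-- The property of a line `D` that is tested by its gate: the value `0` stands for `A` and `1`
for `B`. -/
def Claim (mono : Bool) (α : Name → Bool) (g : Bool) (D : AClause Name) : Prop :=
  (∃ m ∈ D, TrueP mono α g m.lit) ∨
    Forces (F.Falsified g) (F.side g) α {m ∈ D | (Quant.ex, m.lit.var) ∈ F.side g}

variable {F} {mono : Bool} {α : Name → Bool} {g : Bool} {D E : AClause Name}

theorem Claim.inst (τ : Ann Name) (h : F.Claim mono α g D)
    (hDE : ∀ l ∈ D, (TrueP mono α g l.lit ∨ (Quant.ex, l.lit.var) ∈ F.side g) →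
      ∃ m ∈ E, l.InstOf (fun x y => F.withB.ind x < F.withB.ind y) τ m) : F.Claim mono α g E := by
  rcases h with ⟨l, hl, h⟩ | h
  · obtain ⟨m, hm, hlm⟩ := hDE l hl (Or.inl h)
    exact Or.inl ⟨m, hm, by rwa [hlm.1]⟩
  · refine Or.inr (h.inst (lt := fun x y => F.withB.ind x < F.withB.ind y) (τ := τ)
      (F.side_pairwise g) (fun l hl => hl.2) ?_)
    rintro l ⟨hl, hg⟩
    obtain ⟨m, hm, hlm⟩ := hDE l hl (Or.inr hg)
    exact ⟨m, ⟨hm, by rwa [hlm.1]⟩, hlm⟩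

theorem Claim.mono_subset (h : F.Claim mono α g D)
    (hDE : ∀ l ∈ D, ∃ m ∈ E, m.lit = l.lit ∧ ∀ u, Val.Coarsens (l.ann u) (m.ann u)) :
    F.Claim mono α g E :=
  h.inst (fun _ => none) fun l hl _ =>
    let ⟨m, hm, h, h'⟩ := hDE l hl
    ⟨m, hm, ALit.InstOf.of_coarsens h h'⟩

theorem mem_inst {τ : Ann Name} {l : ALit Name} (hl : l ∈ D) :
    ∃ m ∈ F.withB.inst τ D, l.InstOf (fun x y => F.withB.ind x < F.withB.ind y) τ m :=
  ⟨_, ⟨l, hl, rfl⟩, rfl, fun u hu => by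
    simp only [QBF.restrict, if_pos hu]
    exact Val.Coarsens.refl _⟩

theorem AllEx.inst {τ : Ann Name} (h : F.AllEx D) : F.AllEx (F.withB.inst τ D) := by
  rintro m ⟨l, hl, rfl⟩
  exact h l hl

theorem Claim.instantiation (h : F.Claim mono α g D) (hE : F.withB.IsInstantiation D E) :
    F.Claim mono α g E := by
  obtain ⟨τ, -, -, rfl⟩ := hE
  exact h.inst τ fun l hl _ => mem_inst hl

theorem coarsens_merge {μ σ : Ann Name} (h : μ.SameDom σ) (u : Name) :
    Val.Coarsens (μ u) (μ.merge σ u) ∧ Val.Coarsens (σ u) (μ.merge σ u) := by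
  by_cases hu : μ u = σ u
  · simp [Ann.merge, ← hu, Val.Coarsens]
  · have h1 : μ u ≠ none := fun h' => hu (h'.trans ((h u).1 h').symm)
    have h2 : σ u ≠ none := fun h' => h1 ((h u).2 h')
    simp [Ann.merge, hu, Val.Coarsens, h1, h2]

/-- Both merged literals are coarsened to the new one, and a coarser annotation permits at least the
same committed moves. -/
theorem Claim.merging (h : F.Claim mono α g D) (hE : QBF.IsMerging D E) : F.Claim mono α g E := by
  obtain ⟨C, b, μ, σ, hd, rfl, rfl⟩ := hE
  refine h.mono_subset fun l hl => ?_
  rcases hl with rfl | rfl | hl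
  · exact ⟨_, Set.mem_insert _ _, rfl, fun u => (coarsens_merge hd u).1⟩
  · exact ⟨_, Set.mem_insert _ _, rfl, fun u => (coarsens_merge hd u).2⟩
  · exact ⟨l, Set.mem_insert_of_mem _ hl, rfl, fun u => Val.Coarsens.refl _⟩

theorem AllEx.merging (h : F.AllEx D) (hE : QBF.IsMerging D E) : F.AllEx E := by
  obtain ⟨C, b, μ, σ, -, rfl, rfl⟩ := hE
  rintro l (rfl | hl)
  · exact h ⟨b, μ⟩ (Set.mem_insert _ _)
  · exact h l (Set.mem_insert_of_mem _ (Set.mem_insert_of_mem _ hl))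

/-- All literals on `b` in an axiom have the same sign, so it does not matter that a scan retains
the last one, nor how often it is listed. -/
theorem axFlag_eq {s : Bool} (C : List (Literal Name)) (h : ∀ l ∈ C, l.var = Name.b → l.pos = s)
    (v : Bool) : axFlag v C = if ∃ l ∈ C, l.var = Name.b then s else v := by
  induction C generalizing v with
  | nil => simp [axFlag]
  | cons l C ih =>
    rw [axFlag, ih fun l hl => h l (List.mem_cons_of_mem _ hl)]
    have := h l (by simp)
    by_cases hl : l.var = Name.b
    · simp [hl, this hl]
    · simp [hl]

theorem b_notMem_cnf {C : Finset (Literal Name)} (hC : C ∈ F.cnf g) {l : Literal Name}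
    (hl : l ∈ C) : l.var ≠ Name.b := by
  rcases F.cnf_vars hC hl with ⟨i, -, h⟩ | h
  · simp [h]
  · cases g <;> simp [side] at h <;> obtain ⟨i, -, h⟩ := h <;> simp [← h]

theorem Claim.ofAxiom (hA : mono = true → F.PositiveInA) {C : List (Literal Name)}
    (hE : F.withB.IsAxiom C.toFinset E) : F.Claim mono α (!axFlag false C) E := by
  obtain ⟨hC, rfl⟩ := hE
  obtain ⟨g, C₀, hC₀, hC₀C⟩ : ∃ g, ∃ C₀ ∈ F.cnf g, insert ⟨Name.b, !g⟩ C₀ = C.toFinset := by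
    rcases Finset.mem_union.1 hC with h | h <;> obtain ⟨C₀, h, h'⟩ := Finset.mem_image.1 h
    · exact ⟨false, C₀, h, h'⟩
    · exact ⟨true, C₀, h, h'⟩
  have hflag : (!axFlag false C) = g := by
    have hmem : ∀ l, l ∈ C ↔ l = ⟨Name.b, !g⟩ ∨ l ∈ C₀ := fun l => by
      rw [← List.mem_toFinset, ← hC₀C, Finset.mem_insert]
    rw [axFlag_eq (s := !g), if_pos ⟨_, (hmem _).2 (Or.inl rfl), rfl⟩, Bool.not_not]
    intro l hl hb
    rcases (hmem l).1 hl with rfl | hl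
    · rfl
    · exact absurd hb (b_notMem_cnf hC₀ hl)
  rw [hflag]
  have hsub : ∀ l ∈ C₀, l ∈ C.toFinset := fun l hl => hC₀C ▸ Finset.mem_insert_of_mem hl
  have hlit : ∀ l ∈ C₀, F.withB.IsEx l.var → ∃ m ∈ {m | ∃ l ∈ C.toFinset, F.withB.IsEx l.var ∧
      m = F.withB.restrict l (F.withB.falsifier C.toFinset)}, m.lit = l ∧
      ∀ u, F.withB.ind u < F.withB.ind l.var → m.ann u = F.withB.falsifier C.toFinset u :=
    fun l hl hex => ⟨_, ⟨l, hsub l hl, hex, rfl⟩, rfl, fun u hu => if_pos hu⟩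
  -- A true p-literal witnesses the first alternative of the claim; in the monotone case for `A` it
  -- is positive by `hA`. Without one, falsifying the remaining literals falsifies `C₀`.
  by_cases hp : ∃ l ∈ C₀, (∃ i, l.var = Name.p i) ∧ α l.var = l.pos
  · obtain ⟨l, hl, ⟨i, hi⟩, hα⟩ := hp
    have hex : F.withB.IsEx l.var := by
      rw [F.isEx_iff]
      rcases F.cnf_vars hC₀ hl with h | h
      · exact Or.inl h
      · cases g <;> simp [side, hi] at h
    obtain ⟨m, hm, h, -⟩ := hlit l hl hex
    refine Or.inl ⟨m, hm, ?_⟩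
    rw [h]
    refine ⟨⟨i, hi⟩, hα, ?_⟩
    rintro rfl hmono
    by_contra hneg
    refine hA hmono C₀ hC₀ i ?_
    convert! hl
    · exact hi.symm
    · simpa using hneg
  · refine Or.inr (Forces.axiom_clause (C := C₀) (f := F.withB.falsifier C.toFinset)
      (lt := fun x y => F.withB.ind x < F.withB.ind y) (fun x => lt_irrefl _) ?_
      (F.side_pairwise g) ?_ ?_ ?_)
    · intro u v hu hl
      have hl := hsub _ hl
      have hnt := F.withB.nontaut _ hC u
      simp only [QBF.falsifier] at hu
      cases v <;> simp only [Val.ofBool] at hu <;> split_ifs at hu <;> simp_all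
    · intro u hu v hv
      have hv := hsub _ hv
      have hu : F.withB.IsUniv u := (F.side_sublist g).subset hu
      simp only [QBF.falsifier, if_pos hu]
      split_ifs with h1 h2
      · exact ⟨false, rfl⟩
      · exact ⟨true, rfl⟩
      · cases v
        · exact absurd hv h2
        · exact absurd hv h1
    · intro β hβ hβC
      refine ⟨C₀, hC₀, fun l hl => ?_⟩
      by_cases hs : l.var ∈ (F.side g).map Prod.snd
      · exact hβC l hl hs
      · obtain ⟨i, hi, h⟩ := (F.cnf_vars hC₀ hl).resolve_right hs
        rw [hβ _ hs]
        exact fun hα => hp ⟨l, hl, ⟨i, h⟩, hα⟩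
    · intro l hl hx
      obtain ⟨m, hm, h, h'⟩ := hlit l hl ((F.isEx_iff _).2 (Or.inr ⟨g, hx⟩))
      exact ⟨m, ⟨hm, by rwa [h]⟩, h, h'⟩

theorem AllEx.ofAxiom {C : Finset (Literal Name)} (hE : F.withB.IsAxiom C E) : F.AllEx E := by
  obtain ⟨-, rfl⟩ := hE
  rintro m ⟨l, -, hl, rfl⟩
  exact hl

theorem AllEx.resolution {x : Name} {D₁ D₂ : AClause Name} (h₁ : F.AllEx D₁) (h₂ : F.AllEx D₂)
    (hE : F.withB.IsResolution x D₁ D₂ E) : F.AllEx E := by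
  obtain ⟨τ, ξ, σ, C₁, C₂, -, -, -, -, rfl, rfl, rfl⟩ := hE
  have h₁' : F.AllEx C₁ := fun l hl => h₁ l (Set.mem_insert_of_mem _ hl)
  have h₂' : F.AllEx C₂ := fun l hl => h₂ l (Set.mem_insert_of_mem _ hl)
  rintro l (hl | hl)
  · exact h₁'.inst l hl
  · exact h₂'.inst l hl

theorem AllEx.pivot {x : Name} {D₁ D₂ : AClause Name} (h₁ : F.AllEx D₁)
    (hE : F.withB.IsResolution x D₁ D₂ E) : F.withB.IsEx x := by
  obtain ⟨τ, ξ, σ, C₁, C₂, -, -, -, -, rfl, -, -⟩ := hE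
  exact h₁ _ (Set.mem_insert _ _)

/-- A premise alone suffices when its pivot is neither a p-literal counted as true nor a literal of
its own half. The two games have to be combined only if both premises have the same bit and the
pivot lies in that half. -/
theorem Claim.resolution {x : Name} {D₁ D₂ : AClause Name} {g₁ g₂ : Bool}
    (hx : F.withB.IsEx x) (h₁ : F.Claim mono α g₁ D₁) (h₂ : F.Claim mono α g₂ D₂)
    (hE : F.withB.IsResolution x D₁ D₂ E) :
    F.Claim mono α (resVal mono (fun i => α (Name.p i)) x g₁ g₂) E := by
  obtain ⟨τ, ξ, σ, C₁, C₂, hd₁, hd₂, hd₃, hτ, rfl, rfl, rfl⟩ := hE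
  -- a premise suffices if its pivot does not matter
  have left : (TrueP mono α g₁ ⟨x, true⟩ ∨ (Quant.ex, x) ∈ F.side g₁ → False) →
      F.Claim mono α g₁ (F.withB.inst σ C₁ ∪ F.withB.inst ξ C₂) := by
    intro h
    refine h₁.inst σ fun l hl hl' => ?_
    rcases hl with rfl | hl
    · exact (h hl').elim
    · obtain ⟨m, hm, hlm⟩ := mem_inst (F := F) (τ := σ) hl
      exact ⟨m, Or.inl hm, hlm⟩
  have right : (TrueP mono α g₂ ⟨x, false⟩ ∨ (Quant.ex, x) ∈ F.side g₂ → False) →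
      F.Claim mono α g₂ (F.withB.inst σ C₁ ∪ F.withB.inst ξ C₂) := by
    intro h
    refine h₂.inst ξ fun l hl hl' => ?_
    rcases hl with rfl | hl
    · exact (h hl').elim
    · obtain ⟨m, hm, hlm⟩ := mem_inst (F := F) (τ := ξ) hl
      exact ⟨m, Or.inr hm, hlm⟩
  have both : g₁ = g₂ → (∀ i, x ≠ Name.p i) →
      F.Claim mono α g₁ (F.withB.inst σ C₁ ∪ F.withB.inst ξ C₂) := by
    rintro rfl hp
    rcases h₁ with ⟨l, hl, ht⟩ | h₁'
    · rcases hl with rfl | hl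
      · exact absurd ht.1 (by simpa using hp)
      · obtain ⟨m, hm, hlm⟩ := mem_inst (F := F) (τ := σ) hl
        exact Or.inl ⟨m, Or.inl hm, by rwa [hlm.1]⟩
    rcases h₂ with ⟨l, hl, ht⟩ | h₂'
    · rcases hl with rfl | hl
      · exact absurd ht.1 (by simpa using hp)
      · obtain ⟨m, hm, hlm⟩ := mem_inst (F := F) (τ := ξ) hl
        exact Or.inl ⟨m, Or.inr hm, by rwa [hlm.1]⟩
    refine Or.inr (Forces.resolution (lt := fun x y => F.withB.ind x < F.withB.ind y)
      (x := x) hd₃ hτ (F.side_pairwise g₁) (fun l hl => hl.2)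
      (fun l hl => hl.2) h₁' h₂' ?_ ?_)
    · rintro l ⟨hl, hs⟩
      rcases hl with rfl | hl
      · exact Or.inl rfl
      · obtain ⟨m, hm, hlm⟩ := mem_inst (F := F) (τ := σ) hl
        exact Or.inr ⟨m, ⟨Or.inl hm, by rwa [hlm.1]⟩, hlm⟩
    · rintro l ⟨hl, hs⟩
      rcases hl with rfl | hl
      · exact Or.inl rfl
      · obtain ⟨m, hm, hlm⟩ := mem_inst (F := F) (τ := ξ) hl
        exact Or.inr ⟨m, ⟨Or.inr hm, by rwa [hlm.1]⟩, hlm⟩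
  have hside : ∀ i g, (Quant.ex, Name.p i) ∉ F.side g := by
    intro i g
    cases g <;> simp [side]
  rcases x with i | _ | i | i
  · simp only [hside, or_false] at left right
    have hleft : α (Name.p i) = false → F.Claim mono α g₁ _ := fun h =>
      left fun h' => by simpa [h] using h'.2.1
    have hright : α (Name.p i) = true → F.Claim mono α g₂ _ := fun h =>
      right fun h' => by simpa [h] using h'.2.1
    cases hα : α (Name.p i) with
    | true => simpa [resVal, hα] using hright hα
    | false =>
      cases hm : mono with
      | false => simpa [resVal, hα, hm] using hleft hα
      | true =>
        cases hg : g₂ with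
        | true => simpa [resVal, hα, hm, hg] using hleft hα
        | false =>
          -- With bit 0 the monotone claim does not count negative p-literals, so the second premise
          -- can be used although its pivot is true under `α`.
          have := right fun h' => by simpa using h'.2.2 hg hm
          simpa [resVal, hα, hm, hg] using this
  · rcases (F.isEx_iff _).1 hx with ⟨i, -, h⟩ | ⟨g, h⟩
    · simp at h
    · cases g <;> simp [side] at h
  -- A pivot in q does not occur in the game of `B`, so any premise with bit 1 can be kept without
  -- it; two bits 0 call for the game resolution. For r the roles are exchanged.
  · cases h1 : g₁ with
    | true =>
      have := left fun h => by simp [TrueP, side, h1] at h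
      simpa [resVal, h1] using this
    | false =>
      cases h2 : g₂ with
      | true =>
        have := right fun h => by simp [TrueP, side, h2] at h
        simpa [resVal, h1, h2] using this
      | false =>
        have := both (by rw [h1, h2]) (by simp)
        simpa [resVal, h1] using this
  · cases h1 : g₁ with
    | false =>
      have := left fun h => by simp [TrueP, side, h1] at h
      simpa [resVal, h1] using this
    | true =>
      cases h2 : g₂ with
      | false =>
        have := right fun h => by simp [TrueP, side, h2] at h
        simpa [resVal, h1, h2] using this
      | true =>
        have := both (by rw [h1, h2]) (by simp)
        simpa [resVal, h1] using this

theorem take_getElem?_eq_some {π : Proof Name} {k i : ℕ} {d : Line Name}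
    (h : (π.take k)[i]? = some d) : ∃ h : i < π.length, i < k ∧ π[i] = d := by
  obtain ⟨hi, h⟩ := List.getElem?_eq_some_iff.1 h
  simp only [List.length_take, lt_min_iff] at hi
  exact ⟨hi.2, hi.1, by simpa using h⟩

variable {π : Proof Name}

theorem premises_lt {ln : Line Name} {k : ℕ} (h : ln.Valid F.withB (π.take k)) :
    ∀ i ∈ ln.rule.premises, i < k := by
  rw [Line.Valid] at h
  rcases hr : ln.rule with C | i | i | ⟨i, j, x⟩ <;> simp only [hr] at h <;>
    simp only [Rule.premises, List.mem_cons, List.not_mem_nil, or_false, forall_eq_or_imp,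
      forall_eq, IsEmpty.forall_iff, implies_true]
  · obtain ⟨d, hd, -⟩ := h
    exact (take_getElem?_eq_some hd).2.1
  · obtain ⟨d, hd, -⟩ := h
    exact (take_getElem?_eq_some hd).2.1
  · obtain ⟨d, d', hd, hd', -⟩ := h
    exact ⟨(take_getElem?_eq_some hd).2.1, (take_getElem?_eq_some hd').2.1⟩

/-- Makes every pivot existential: this excludes `b` and keeps the indices of input gates below
`nP`. -/
theorem allEx_line (hπ : ∀ (k : ℕ) (hk : k < π.length), Line.Valid F.withB (π.take k) π[k])
    (k : ℕ) (hk : k < π.length) : F.AllEx π[k].denote := by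
  induction k using Nat.strong_induction_on with
  | _ k ih =>
    have h := hπ k hk
    rw [Line.Valid] at h
    rcases hr : π[k].rule with C | i | i | ⟨i, j, x⟩ <;> simp only [hr] at h
    · exact AllEx.ofAxiom h
    · obtain ⟨d, hd, τ, -, -, hE⟩ := h
      obtain ⟨hi, hik, rfl⟩ := take_getElem?_eq_some hd
      rw [hE]
      exact (ih i hik hi).inst
    · obtain ⟨d, hd, hE⟩ := h
      obtain ⟨hi, hik, rfl⟩ := take_getElem?_eq_some hd
      exact (ih i hik hi).merging hE
    · obtain ⟨d, d', hd, hd', hE⟩ := h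
      obtain ⟨hi, hik, rfl⟩ := take_getElem?_eq_some hd
      obtain ⟨hj, hjk, rfl⟩ := take_getElem?_eq_some hd'
      exact (ih i hik hi).resolution (ih j hjk hj) hE

theorem claim_line (hA : mono = true → F.PositiveInA)
    (hπ : ∀ (k : ℕ) (hk : k < π.length), Line.Valid F.withB (π.take k) π[k])
    (α : Name → Bool) (k : ℕ) (hk : k < π.length) :
    F.Claim mono α (lineVal mono π (fun i => α (Name.p i)) k) π[k].denote := by
  induction k using Nat.strong_induction_on with
  | _ k ih =>
    have h := hπ k hk
    rw [lineVal_eq mono π _ hk (premises_lt h)]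
    rw [Line.Valid] at h
    rcases hr : π[k].rule with C | i | i | ⟨i, j, x⟩ <;> simp only [hr] at h
    · exact Claim.ofAxiom hA h
    · obtain ⟨d, hd, hE⟩ := h
      obtain ⟨hi, hik, rfl⟩ := take_getElem?_eq_some hd
      exact (ih i hik hi).instantiation hE
    · obtain ⟨d, hd, hE⟩ := h
      obtain ⟨hi, hik, rfl⟩ := take_getElem?_eq_some hd
      exact (ih i hik hi).merging hE
    · obtain ⟨d, d', hd, hd', hE⟩ := h
      obtain ⟨hi, hik, rfl⟩ := take_getElem?_eq_some hd
      obtain ⟨hj, hjk, rfl⟩ := take_getElem?_eq_some hd'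
      exact (ih i hik hi).resolution ((allEx_line hπ i hi).pivot hE) (ih j hjk hj) hE

theorem wellFormed_extract (mono : Bool) (hπ : IsRefutation F.withB π) :
    (extract mono π).WellFormed F.nP := by
  obtain ⟨hv, ln, hln, -⟩ := hπ
  refine ⟨?_, ?_, ?_⟩
  · intro h
    have h := congrArg List.length h
    rw [extract, length_blocks, List.length_nil] at h
    have : π = [] := List.length_eq_zero_iff.1 (by omega)
    simp [this] at hln
  · have := wellFormedFrom_blocks mono (k := 0) (π := π) fun i hi j hj => by
      simpa using premises_lt (hv i hi) j hj
    intro k hk j hj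
    simpa using this.getElem k hk j hj
  · intro m hm
    obtain ⟨ln, hln, k', h⟩ := mem_blocks hm
    obtain ⟨i, j, hR⟩ := input_mem_block h
    obtain ⟨k, hk, rfl⟩ := List.mem_iff_getElem.1 hln
    have h := hv k hk
    rw [Line.Valid, hR] at h
    obtain ⟨d, d', hd, -, hE⟩ := h
    obtain ⟨hi, -, rfl⟩ := take_getElem?_eq_some hd
    rcases (F.isEx_iff _).1 ((allEx_line hv i hi).pivot hE) with ⟨n, hn, h⟩ | ⟨g, h⟩
    · cases h
      exact hn
    · cases g <;> simp [side] at h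

theorem computesB_extract (hA : mono = true → F.PositiveInA) (hπ : IsRefutation F.withB π) :
    F.ComputesB (extract mono π) := by
  have hwf := wellFormed_extract mono hπ
  refine ⟨hwf, F.exists_winning (fun α => (extract mono π).eval fun i => α (Name.p i)) ?_ ?_⟩
  · intro α β h
    have : (extract mono π).values (fun i => α (Name.p i)) =
        (extract mono π).values (fun i => β (Name.p i)) :=
      evalFrom_congr (fun i hi => h i (hwf.2.2 i hi)) []
    simp only [Circuit.eval, this]
  · intro α
    obtain ⟨hv, ln, hln, hempty⟩ := hπ
    have hne : π ≠ [] := by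
      rintro rfl
      simp at hln
    have hlast : π.length - 1 < π.length := Nat.sub_lt (List.length_pos_iff.2 hne) one_pos
    have h := claim_line hA hv α _ hlast
    have hd : π[π.length - 1].denote = ∅ := by
      rw [List.getLast?_eq_getElem?, List.getElem?_eq_getElem hlast, Option.some_inj] at hln
      rw [hln, hempty]
    rw [hd] at h
    simp only [eval_extract mono hne]
    simpa [Claim] using h

end Setting

/-! ### Machines given by a table -/

open Function

/-- A machine that in every step pops a symbol from a stack and then, depending on this symbol,
pushes some symbols and jumps. -/
structure Table (K Γ Λ : Type) where
  stack : Λ → K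
  act : Λ → Option Γ → List (K × Γ)
  next : Λ → Option Γ → Option Λ

namespace Table

variable {K Γ Λ : Type}

/-- A bound on the pushes per step bounds the length of the output by the running time, and hence
the time needed to reverse it. -/
theorem exists_act_bound (T : Table K Γ Λ) [Finite Λ] [Finite Γ] :
    ∃ B, ∀ l v, (T.act l v).length ≤ B := by
  obtain ⟨B, hB⟩ := (Set.finite_range fun p : Λ × Option Γ => (T.act p.1 p.2).length).bddAbove
  exact ⟨B, fun l v => hB ⟨(l, v), rfl⟩⟩

variable [DecidableEq K]

def pushAll (ps : List (K × Γ)) (S : K → List Γ) : K → List Γ :=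
  ps.foldl (fun S p => update S p.1 (p.2 :: S p.1)) S

variable (T : Table K Γ Λ)

/-- The next configuration. -/
def step (l : Λ) (S : K → List Γ) : Option Λ × (K → List Γ) :=
  (T.next l (S (T.stack l)).head?, pushAll (T.act l (S (T.stack l)).head?)
    (update S (T.stack l) (S (T.stack l)).tail))

/-- The second configuration is reached from the first one in at most `n` steps. -/
inductive Run : ℕ → Option Λ × (K → List Γ) → Option Λ × (K → List Γ) → Prop
  | refl (n : ℕ) (c) : Run n c c
  | step {n : ℕ} {l : Λ} {S : K → List Γ} {c} (h : Run n (T.step l S) c) : Run (n + 1) (some l, S) c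

variable {T} {l : Λ} {S : K → List Γ} {c d e : Option Λ × (K → List Γ)} {n m : ℕ}

theorem Run.head (h' : T.Run n c d) (h : T.step l S = c) : T.Run (n + 1) (some l, S) d :=
  .step (h ▸ h')

theorem Run.le (h : T.Run n c d) (hnm : n ≤ m) : T.Run m c d := by
  induction h generalizing m with
  | refl n c => exact .refl m c
  | step h ih =>
    obtain ⟨m, rfl⟩ := Nat.exists_eq_succ_of_ne_zero (by omega : m ≠ 0)
    exact .step (ih (by omega))

theorem Run.trans (h : T.Run n c d) (h' : T.Run m d e) : T.Run (n + m) c e := by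
  induction h with
  | refl n c => exact h'.le (by omega)
  | step h ih => exact (Run.step (ih h')).le (by omega)

theorem length_pushAll_le (ps : List (K × Γ)) (S : K → List Γ) (k : K) :
    (pushAll ps S k).length ≤ (S k).length + ps.length := by
  induction ps generalizing S with
  | nil => simp [pushAll]
  | cons p ps ih =>
    refine (ih _).trans ?_
    by_cases hk : k = p.1
    · subst hk
      simp only [update_self, List.length_cons]
      omega
    · simp only [update_of_ne hk, List.length_cons]
      omega

theorem Run.length_le {B : ℕ} (hB : ∀ l v, (T.act l v).length ≤ B) (h : T.Run n c d) (k : K) :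
    (d.2 k).length ≤ (c.2 k).length + B * n := by
  induction h with
  | refl n c => omega
  | @step n l S c h ih =>
    refine ih.trans ?_
    have h1 := length_pushAll_le (T.act l (S (T.stack l)).head?)
      (update S (T.stack l) (S (T.stack l)).tail) k
    have h2 := hB l (S (T.stack l)).head?
    have h3 : (update S (T.stack l) (S (T.stack l)).tail k).length ≤ (S k).length := by
      by_cases hk : k = T.stack l
      · subst hk
        simp
      · simp [update_of_ne hk]
    have h4 : ((T.step l S).2 k).length ≤ (S k).length + B := by
      simp only [Table.step]
      omega
    simp only [Nat.mul_succ]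
    omega

/-! ### Compilation of tables into `TM2` machines -/

variable (T)

open Turing

/-- Pushing, and then a jump with the register cleared. -/
def pushStmt (next : Option Λ) : List (K × Γ) → TM2.Stmt (fun _ : K => Γ) Λ (Option Γ)
  | [] => .load (fun _ => none) (match next with
    | some l => .goto fun _ => l
    | none => .halt)
  | p :: ps => .push p.1 (fun _ => p.2) (pushStmt next ps)

/-- A case distinction on the contents of the register. -/
def select [DecidableEq Γ] (q : Option Γ → TM2.Stmt (fun _ : K => Γ) Λ (Option Γ)) :
    List (Option Γ) → TM2.Stmt (fun _ : K => Γ) Λ (Option Γ)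
  | [] => .halt
  | v :: vs => .branch (fun s => s = v) (q v) (select q vs)

/-- The internal state serves as a register for the popped symbol and is empty between steps, so
that one table step is exactly one `TM2.step`. -/
noncomputable def stmt [DecidableEq Γ] [Fintype Γ] (l : Λ) :
    TM2.Stmt (fun _ : K => Γ) Λ (Option Γ) :=
  .pop (T.stack l) (fun _ s => s)
    (select (fun v => pushStmt (T.next l v) (T.act l v)) Finset.univ.toList)

theorem stepAux_pushStmt (next : Option Λ) (ps : List (K × Γ)) (v : Option Γ) (S : K → List Γ) :
    TM2.stepAux (pushStmt next ps) v S = ⟨next, none, pushAll ps S⟩ := by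
  induction ps generalizing S with
  | nil => cases next <;> rfl
  | cons p ps ih => exact ih _

theorem stepAux_select [DecidableEq Γ] (q : Option Γ → TM2.Stmt (fun _ : K => Γ) Λ (Option Γ))
    {vs : List (Option Γ)} {v : Option Γ} (hv : v ∈ vs) (S : K → List Γ) :
    TM2.stepAux (select q vs) v S = TM2.stepAux (q v) v S := by
  induction vs with
  | nil => simp at hv
  | cons w vs ih =>
    by_cases h : v = w
    · simp [select, h]
    · simp only [select, TM2.stepAux, h, decide_false, cond_false]
      exact ih ((List.mem_cons.1 hv).resolve_left h)

theorem tm_step [DecidableEq Γ] [Fintype Γ] (l : Λ) (S : K → List Γ) :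
    TM2.step T.stmt ⟨some l, none, S⟩ = some ⟨(T.step l S).1, none, (T.step l S).2⟩ := by
  simp only [TM2.step, stmt, TM2.stepAux]
  rw [stepAux_select _ (by simp), stepAux_pushStmt]
  rfl

variable {T}

theorem Run.iterate [DecidableEq Γ] [Fintype Γ] (h : T.Run n c d) :
    ∃ m ≤ n, (flip bind (TM2.step T.stmt))^[m]
      (some ⟨c.1, none, c.2⟩) = some ⟨d.1, none, d.2⟩ := by
  induction h with
  | refl n c => exact ⟨0, Nat.zero_le _, rfl⟩
  | @step n l S c h ih =>
    obtain ⟨m, hm, h⟩ := ih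
    refine ⟨m + 1, by omega, ?_⟩
    rw [iterate_succ_apply, ← h]
    congr 1
    exact T.tm_step l S

end Table

/-! ### Binary numbers -/

theorem encodeList_eq {α : Type} (e : α → List Sym) (l : List α) :
    encodeList e l = l.flatMap (fun x => Sym.cons :: e x) ++ [Sym.nil] := by
  induction l with
  | nil => rfl
  | cons x l ih => simp [encodeList, ih]

/-- Addition of one, for binary numbers with the least significant digit first. -/
def incBits : List Bool → List Bool
  | [] => [true]
  | false :: l => true :: l
  | true :: l => false :: incBits l

theorem encodePosNum_succ (p : PosNum) :
    Computability.encodePosNum p.succ = incBits (Computability.encodePosNum p) := by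
  induction p with
  | one => rfl
  | bit1 p ih => simp [PosNum.succ, Computability.encodePosNum, incBits, ih]
  | bit0 p ih => simp [PosNum.succ, Computability.encodePosNum, incBits]

theorem encodeNat_succ (n : ℕ) :
    Computability.encodeNat (n + 1) = incBits (Computability.encodeNat n) := by
  simp only [Computability.encodeNat, Nat.cast_add, Nat.cast_one, Num.add_one]
  cases (n : Num) with
  | zero => rfl
  | pos p => exact encodePosNum_succ p

theorem encodeNat_two_mul_add_one (n : ℕ) :
    Computability.encodeNat (2 * n + 1) = true :: Computability.encodeNat n := by
  induction n with
  | zero => rfl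
  | succ n ih =>
    rw [show 2 * (n + 1) + 1 = 2 * n + 1 + 1 + 1 by ring, encodeNat_succ, encodeNat_succ, ih,
      encodeNat_succ]
    rfl

theorem encodeNat_two_mul {n : ℕ} (hn : n ≠ 0) :
    Computability.encodeNat (2 * n) = false :: Computability.encodeNat n := by
  obtain ⟨n, rfl⟩ := Nat.exists_eq_succ_of_ne_zero hn
  rw [show 2 * (n + 1) = 2 * n + 1 + 1 by ring, encodeNat_succ, encodeNat_two_mul_add_one,
    encodeNat_succ]
  rfl

theorem length_incBits_le (l : List Bool) : (incBits l).length ≤ l.length + 1 := by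
  induction l with
  | nil => simp [incBits]
  | cons b l ih => cases b <;> simp [incBits, ih]

theorem length_encodeNat_le (n : ℕ) : (Computability.encodeNat n).length ≤ n := by
  induction n with
  | zero => simp [Computability.encodeNat, Computability.encodeNum]
  | succ n ih =>
    rw [encodeNat_succ]
    have := length_incBits_le (Computability.encodeNat n)
    omega

def bits (n : ℕ) : List Sym := (Computability.encodeNat n).map Sym.bit

/-- The first four digits of `16 * k + o`. -/
def digits (o : ℕ) : List Sym :=
  [Sym.bit (o.testBit 0), Sym.bit (o.testBit 1), Sym.bit (o.testBit 2), Sym.bit (o.testBit 3)]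

/-- For `8 ≤ o` the fourth digit is 1, so all four digits are present even for `k = 0`, when a
leading zero would be dropped. This is why blocks begin with eight padding gates. -/
theorem encodeNat_sixteen_mul_add (k : ℕ) {o : ℕ} (h8 : 8 ≤ o) (h16 : o < 16) :
    encodeNat (16 * k + o) = digits o ++ (bits k ++ [Sym.endNat]) := by
  have h1 := encodeNat_two_mul_add_one k
  have h2 := encodeNat_two_mul_add_one (2 * k + 1)
  have h3 := encodeNat_two_mul (n := 2 * k + 1) (by omega)
  have e4 := encodeNat_two_mul (n := 2 * (2 * k + 1)) (by omega)
  have e5 := encodeNat_two_mul_add_one (2 * (2 * k + 1))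
  have e6 := encodeNat_two_mul (n := 2 * (2 * k + 1) + 1) (by omega)
  have e7 := encodeNat_two_mul_add_one (2 * (2 * k + 1) + 1)
  have key : ∀ m, m ∈ [4, 5, 6, 7] → Computability.encodeNat (8 * k + m) =
      m.testBit 0 :: m.testBit 1 :: true :: Computability.encodeNat k := by
    intro m hm
    simp only [List.mem_cons, List.not_mem_nil, or_false] at hm
    rcases hm with rfl | rfl | rfl | rfl
    · rw [show 8 * k + 4 = 2 * (2 * (2 * k + 1)) by ring, e4, h3, h1]
      rfl
    · rw [show 8 * k + 5 = 2 * (2 * (2 * k + 1)) + 1 by ring, e5, h3, h1]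
      rfl
    · rw [show 8 * k + 6 = 2 * (2 * (2 * k + 1) + 1) by ring, e6, h2, h1]
      rfl
    · rw [show 8 * k + 7 = 2 * (2 * (2 * k + 1) + 1) + 1 by ring, e7, h2, h1]
      rfl
  rcases Nat.even_or_odd' o with ⟨m, rfl | rfl⟩
  · have hm : m ∈ [4, 5, 6, 7] := by simp; omega
    rw [encodeNat, show 16 * k + 2 * m = 2 * (8 * k + m) by ring,
      encodeNat_two_mul (by omega), key m hm]
    simp only [List.mem_cons, List.not_mem_nil, or_false] at hm
    rcases hm with rfl | rfl | rfl | rfl <;> rfl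
  · have hm : m ∈ [4, 5, 6, 7] := by simp; omega
    rw [encodeNat, show 16 * k + (2 * m + 1) = 2 * (8 * k + m) + 1 by ring,
      encodeNat_two_mul_add_one, key m hm]
    simp only [List.mem_cons, List.not_mem_nil, or_false] at hm
    rcases hm with rfl | rfl | rfl | rfl <;> rfl


/-! ### The machine that extracts the circuit -/

/-- The stacks: the input, the reversed output, the current line number, a buffer, and the
output. -/
inductive Stk
  | inp
  | out
  | cnt
  | tmp
  | res
  deriving DecidableEq

instance : Fintype Stk := ⟨{.inp, .out, .cnt, .tmp, .res}, fun k => by cases k <;> simp⟩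

/-- The numbers that are copied from the input to the output. -/
inductive NumPos
  | only
  | left
  | right
  | pivot
  deriving DecidableEq

instance : Fintype NumPos := ⟨{.only, .left, .right, .pivot}, fun k => by cases k <;> simp⟩

/-- In `clause`, `sign` is the last sign read and `flag` the last sign read on `b`. In `copy` and
`back`, the index counts the eight occurrences of the line number in the last five gates. -/
inductive Lab
  | start
  | rule
  | clause (sign flag : Bool)
  | num (m : NumPos)
  | skipNum (c : Kind)
  | name
  | copy (c : Kind) (i : Fin 8)
  | back (c : Kind) (i : Fin 8)
  | skipOuter
  | skipInner
  | inc
  | incBack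
  | clear
  | rev
  deriving Fintype

def selCode₁ : Kind → List Sym
  | .mux => Sym.gateOr :: digits 10
  | .disj => Sym.gateOr :: digits 9
  | .conj => Sym.gateAnd :: digits 10

def selCode₂ (mono : Bool) : Kind → List Sym
  | .mux => (if mono then Sym.gateAnd else Sym.gateNot) :: digits 10
  | .disj => Sym.gateOr :: digits 8
  | .conj => Sym.gateAnd :: digits 10

/-- The code of the second operand, gate `0`, of the second selector gate. -/
def selEnd₂ (mono : Bool) : Kind → List Sym
  | .mux => if mono then [Sym.endNat] else []
  | _ => [Sym.endNat]

/-- The codes of the last five gates of line `k` are these words, with the binary representation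
of `k` between them. -/
def seg (mono : Bool) (c : Kind) : ℕ → List Sym
  | 0 => Sym.cons :: selCode₁ c
  | 1 => Sym.endNat :: Sym.endNat :: Sym.cons :: selCode₂ mono c
  | 2 => Sym.endNat :: (selEnd₂ mono c ++ Sym.cons :: Sym.gateOr :: digits 8)
  | 3 => Sym.endNat :: digits 11
  | 4 => Sym.endNat :: Sym.cons :: Sym.gateOr :: digits 9
  | 5 => Sym.endNat :: digits 12
  | 6 => Sym.endNat :: Sym.cons :: Sym.gateAnd :: digits 13
  | 7 => Sym.endNat :: digits 14
  | _ => [Sym.endNat]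

/-- The code of a list of gates, without the end mark. -/
def gatesCode (gs : List Gate) : List Sym := gs.flatMap fun g => Sym.cons :: encodeGate g

def constCode (v : Bool) : List Sym := [Sym.cons, Sym.gateConst v]

def refCode : List Sym := Sym.cons :: Sym.gateOr :: digits 15

/-- What is written after a number. -/
def afterNum (mono : Bool) : NumPos → List Sym
  | .only => Sym.endNat :: Sym.endNat :: (constCode true ++ constCode false ++ seg mono .conj 0)
  | .left => Sym.endNat :: Sym.endNat :: refCode
  | .right => [Sym.endNat, Sym.endNat]
  | .pivot => Sym.endNat :: seg mono .mux 0

def labAfterNum : NumPos → Lab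
  | .only => .copy .conj 0
  | .left => .num .right
  | .right => .name
  | .pivot => .copy .mux 0

def labAfterBack (c : Kind) (i : Fin 8) : Lab :=
  if h : i.1 + 1 < 8 then .copy c ⟨i.1 + 1, h⟩ else .skipOuter

def machStack : Lab → Stk
  | .copy _ _ => .cnt
  | .back _ _ => .tmp
  | .inc => .cnt
  | .incBack => .tmp
  | .clear => .cnt
  | .rev => .out
  | _ => .inp

/-- The symbols that are written to the output in a step. -/
def machOut (mono : Bool) : Lab → Option Sym → List Sym
  | .start, some .cons => gatesCode (List.replicate 8 (Gate.const false))
  | .start, some .nil => [Sym.nil]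
  | .rule, some .ruleInst => refCode
  | .rule, some .ruleMerge => refCode
  | .rule, some .ruleRes => refCode
  | .clause _ flag, some .nil =>
    constCode (!flag) ++ constCode (!flag) ++ constCode false ++ seg mono .conj 0
  | .num _, some (.bit v) => [.bit v]
  | .num m, some .endNat => afterNum mono m
  | .name, some .varP => [Sym.cons, Sym.gateInput]
  | .name, some .varB => constCode false ++ seg mono .conj 0
  | .name, some .varQ => constCode false
  | .name, some .varR => constCode false
  | .skipNum c, some .endNat => seg mono c 0
  | .copy _ _, some s => [s]
  | .back c i, none => seg mono c (i.1 + 1)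
  | _, _ => []

/-- The symbols that are written to the other stacks. -/
def machAux : Lab → Option Sym → List (Stk × Sym)
  | .copy _ _, some s => [(.tmp, s)]
  | .back _ _, some s => [(.cnt, s)]
  | .inc, some (.bit true) => [(.tmp, .bit false)]
  | .inc, _ => [(.cnt, .bit true)]
  | .incBack, some s => [(.cnt, s)]
  | .rev, some s => [(.res, s)]
  | _, _ => []

/-- The validity of the proof is never checked; only well-formed codes matter. The code of a literal
contains no `nil`, so in `clause` this symbol marks the end of the axiom's clause. -/
def machNext : Lab → Option Sym → Option Lab
  | .start, some .cons => some .rule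
  | .start, some .nil => some .clear
  | .rule, some .ruleAx => some (.clause false false)
  | .rule, some .ruleInst => some (.num .only)
  | .rule, some .ruleMerge => some (.num .only)
  | .rule, some .ruleRes => some (.num .left)
  | .clause _ flag, some (.sign v) => some (.clause v flag)
  | .clause v _, some .varB => some (.clause v v)
  | .clause _ _, some .nil => some (.copy .conj 0)
  | .clause v flag, some _ => some (.clause v flag)
  | .num m, some (.bit _) => some (.num m)
  | .num m, some .endNat => some (labAfterNum m)
  | .name, some .varP => some (.num .pivot)
  | .name, some .varB => some (.copy .conj 0)
  | .name, some .varQ => some (.skipNum .disj)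
  | .name, some .varR => some (.skipNum .conj)
  | .skipNum c, some (.bit _) => some (.skipNum c)
  | .skipNum c, some .endNat => some (.copy c 0)
  | .copy c i, some _ => some (.copy c i)
  | .copy c i, none => some (.back c i)
  | .back c i, some _ => some (.back c i)
  | .back c i, none => some (labAfterBack c i)
  | .skipOuter, some .cons => some .skipInner
  | .skipOuter, some .nil => some .inc
  | .skipInner, some .nil => some .skipOuter
  | .skipInner, some _ => some .skipInner
  | .inc, some (.bit true) => some .inc
  | .inc, _ => some .incBack
  | .incBack, some _ => some .incBack
  | .incBack, none => some .start
  | .clear, some _ => some .clear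
  | .clear, none => some .rev
  | .rev, some _ => some .rev
  | _, _ => none

def machine (mono : Bool) : Table Stk Sym Lab where
  stack := machStack
  act l v := machAux l v ++ (machOut mono l v).map fun s => (Stk.out, s)
  next := machNext

/-- The contents of the stacks. -/
def stks (i o c t r : List Sym) : Stk → List Sym
  | .inp => i
  | .out => o
  | .cnt => c
  | .tmp => t
  | .res => r

open Function Table

section

variable {i o c t r x : List Sym}

theorem update_stks_inp : update (stks i o c t r) .inp x = stks x o c t r := by
  funext k; cases k <;> rfl

theorem update_stks_out : update (stks i o c t r) .out x = stks i x c t r := by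
  funext k; cases k <;> rfl

theorem update_stks_tmp : update (stks i o c t r) .tmp x = stks i o c x r := by
  funext k; cases k <;> rfl

theorem pushAll_out (w : List Sym) :
    pushAll (w.map fun s => (Stk.out, s)) (stks i o c t r) = stks i (w.reverse ++ o) c t r := by
  induction w generalizing o with
  | nil => rfl
  | cons s w ih =>
    simp only [pushAll, List.map_cons, List.foldl_cons, update_stks_out] at ih ⊢
    rw [ih]
    simp [stks]

variable {mono : Bool} {l : Lab} {s : Sym} {n : ℕ} {d : Option Lab × (Stk → List Sym)}

theorem run_inp (hl : machStack l = .inp) (haux : machAux l (some s) = [])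
    (h : (machine mono).Run n (machNext l (some s),
      stks i ((machOut mono l (some s)).reverse ++ o) c t r) d) :
    (machine mono).Run (n + 1) (some l, stks (s :: i) o c t r) d := by
  refine .head h ?_
  simp only [Table.step, machine, hl]
  refine Prod.ext rfl ?_
  simp only [update_stks_inp, stks, List.head?_cons, haux, List.nil_append, List.tail_cons]
  exact pushAll_out _

end

/-! #### Copying the line number -/

theorem run_copy {mono : Bool} {k : Kind} {p : Fin 8} {i r : List Sym} (c : List Sym) :
    ∀ o t, (machine mono).Run (c.length + 1) (some (.copy k p), stks i o c t r)
      (some (.back k p), stks i (c.reverse ++ o) [] (c.reverse ++ t) r) := by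
  induction c with
  | nil => exact fun o t => .head (.refl _ _) (Prod.ext rfl (funext fun k => by cases k <;> rfl))
  | cons s c ih =>
    intro o t
    refine .head (c := (some (.copy k p), stks i (s :: o) c (s :: t) r)) ?_
      (Prod.ext rfl (funext fun k => by cases k <;> rfl))
    simpa using ih (s :: o) (s :: t)

theorem run_back {mono : Bool} {k : Kind} {p : Fin 8} {i o r : List Sym} (t : List Sym) :
    ∀ c, (machine mono).Run (t.length + 1) (some (.back k p), stks i o c t r)
      (some (labAfterBack k p),
        stks i ((seg mono k (p.1 + 1)).reverse ++ o) (t.reverse ++ c) [] r) := by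
  induction t with
  | nil =>
    intro c
    refine .head (.refl _ _) (Prod.ext rfl ?_)
    rw [Table.step]
    simp only [machine, machStack, update_stks_tmp]
    exact pushAll_out _
  | cons s t ih =>
    intro c
    refine .head (c := (some (.back k p), stks i o (s :: c) t r)) ?_
      (Prod.ext rfl (funext fun k => by cases k <;> rfl))
    simpa using ih (s :: c)

/-- Reading the counter destroys it, so it is saved on the buffer while being written out; moving it
back undoes the reversal. -/
theorem run_segment {mono : Bool} {k : Kind} {p : Fin 8} {i o c r : List Sym} :
    (machine mono).Run (2 * c.length + 2) (some (.copy k p), stks i o c [] r)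
      (some (labAfterBack k p),
        stks i ((seg mono k (p.1 + 1)).reverse ++ (c.reverse ++ o)) c [] r) := by
  have h := (run_copy (mono := mono) (k := k) (p := p) (i := i) (r := r) c o []).trans
    (run_back _ _)
  simp only [List.append_nil, List.reverse_reverse, List.length_reverse] at h
  exact h.le (by omega)

theorem gatesCode_tailGates (mono : Bool) (k : ℕ) (c : Kind) :
    gatesCode (tailGates mono k c) = seg mono c 0 ++ (bits k ++ (seg mono c 1 ++ (bits k ++
      (seg mono c 2 ++ (bits k ++ (seg mono c 3 ++ (bits k ++ (seg mono c 4 ++ (bits k ++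
      (seg mono c 5 ++ (bits k ++ (seg mono c 6 ++ (bits k ++ (seg mono c 7 ++ (bits k ++
      seg mono c 8))))))))))))))) := by
  have h0 : encodeNat 0 = [Sym.endNat] := rfl
  cases c <;> cases mono <;>
    simp [gatesCode, tailGates, selGate₁, selGate₂, encodeGate, encodeNat_sixteen_mul_add, seg,
      selCode₁, selCode₂, selEnd₂, h0]

theorem run_tail {mono : Bool} {c : Kind} {k : ℕ} {i o r : List Sym} :
    (machine mono).Run (8 * (2 * (bits k).length + 2))
      (some (.copy c 0), stks i ((seg mono c 0).reverse ++ o) (bits k) [] r)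
      (some .skipOuter, stks i ((gatesCode (tailGates mono k c)).reverse ++ o) (bits k) [] r) := by
  have h : ∀ p o, (machine mono).Run (2 * (bits k).length + 2)
      (some (.copy c p), stks i o (bits k) [] r) _ := fun p o => run_segment
  refine (Run.trans (h 0 _) <| (h 1 _).trans <| (h 2 _).trans <| (h 3 _).trans <| (h 4 _).trans <|
    (h 5 _).trans <| (h 6 _).trans <| (Run.le (m := 2 * (bits k).length + 2) ?_ le_rfl)).le
    (by omega)
  simpa [gatesCode_tailGates, labAfterBack] using h 7 _

/-! #### Reading the rule -/

section

variable {mono : Bool} {c : List Sym} {r : List Sym}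

theorem run_digits {m : NumPos} {i : List Sym} (w : List Bool) : ∀ o,
    (machine mono).Run w.length (some (.num m), stks (w.map Sym.bit ++ i) o c [] r)
      (some (.num m), stks i ((w.map Sym.bit).reverse ++ o) c [] r) := by
  induction w with
  | nil => exact fun o => .refl _ _
  | cons b w ih =>
    intro o
    refine run_inp rfl rfl ?_
    simpa [machNext, machOut] using ih (Sym.bit b :: o)

theorem run_num {m : NumPos} {i : List Sym} (n : ℕ) (o : List Sym) :
    (machine mono).Run (encodeNat n).length (some (.num m), stks (encodeNat n ++ i) o c [] r)
      (some (labAfterNum m), stks i ((bits n ++ afterNum mono m).reverse ++ o) c [] r) := by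
  have h := (run_digits (mono := mono) (c := c) (r := r) (m := m) (i := Sym.endNat :: i)
    (Computability.encodeNat n) o).trans (run_inp (n := 0) rfl rfl (.refl _ _))
  simpa [encodeNat, bits, machNext, machOut] using h

theorem run_skipNum {k : Kind} {i o : List Sym} (n : ℕ) :
    (machine mono).Run (encodeNat n).length (some (.skipNum k), stks (encodeNat n ++ i) o c [] r)
      (some (.copy k 0), stks i ((seg mono k 0).reverse ++ o) c [] r) := by
  rw [encodeNat]
  generalize Computability.encodeNat n = w
  induction w with
  | nil => exact run_inp rfl rfl (.refl _ _)
  | cons b w ih => exact run_inp rfl rfl ih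

theorem run_name {i : List Sym} (x : Name) (o : List Sym) :
    (machine mono).Run (encodeName x).length (some .name, stks (encodeName x ++ i) o c [] r)
      (some (.copy x.kind 0),
        stks i ((gatesCode [pivotGate x] ++ seg mono x.kind 0).reverse ++ o) c [] r) := by
  cases x with
  | p n =>
    refine run_inp rfl rfl ?_
    simpa [machNext, machOut, gatesCode, pivotGate, encodeGate, afterNum, labAfterNum, Name.kind,
      encodeNat, bits] using
      run_num (mono := mono) (c := c) (r := r) (m := .pivot) (i := i) n
        ([Sym.gateInput, Sym.cons] ++ o)
  | b =>
    refine run_inp rfl rfl ?_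
    simpa [machNext, machOut, gatesCode, pivotGate, encodeGate, Name.kind, constCode] using
      Run.refl 0 _
  | q n =>
    refine run_inp rfl rfl ?_
    simpa [machNext, machOut, gatesCode, pivotGate, encodeGate, Name.kind, constCode] using
      run_skipNum n
  | r n =>
    refine run_inp rfl rfl ?_
    simpa [machNext, machOut, gatesCode, pivotGate, encodeGate, Name.kind, constCode] using
      run_skipNum n

theorem run_clause_skip {v f : Bool} {i o : List Sym} (w : List Bool) :
    (machine mono).Run (w.length + 1)
      (some (.clause v f), stks (w.map Sym.bit ++ Sym.endNat :: i) o c [] r)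
      (some (.clause v f), stks i o c [] r) := by
  induction w with
  | nil => exact run_inp rfl rfl (.refl _ _)
  | cons b w ih => exact run_inp rfl rfl ih

theorem run_clause_literal {v f : Bool} {i o : List Sym} (l : Literal Name) :
    (machine mono).Run (encodeLiteral l).length
      (some (.clause v f), stks (encodeLiteral l ++ i) o c [] r)
      (some (.clause l.pos (if l.var = Name.b then l.pos else f)), stks i o c [] r) := by
  obtain ⟨x, s⟩ := l
  refine run_inp rfl rfl ?_
  have key : ∀ n, (machine mono).Run (encodeNat n).length
      (some (.clause s f), stks (encodeNat n ++ i) o c [] r)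
      (some (.clause s f), stks i o c [] r) := by
    intro n
    simpa [encodeNat] using run_clause_skip (mono := mono) (c := c) (r := r) (v := s) (f := f)
      (i := i) (o := o) (Computability.encodeNat n)
  cases x
  · exact run_inp rfl rfl (key _)
  · exact run_inp rfl rfl (.refl _ _)
  · exact run_inp rfl rfl (key _)
  · exact run_inp rfl rfl (key _)

theorem run_clause {i o : List Sym} (C : List (Literal Name)) : ∀ v f,
    (machine mono).Run (encodeList encodeLiteral C).length
      (some (.clause v f), stks (encodeList encodeLiteral C ++ i) o c [] r)
      (some (.copy .conj 0), stks i ((gatesCode [Gate.const !axFlag f C, Gate.const !axFlag f C,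
        Gate.const false] ++ seg mono .conj 0).reverse ++ o) c [] r) := by
  induction C with
  | nil =>
    intro v f
    refine run_inp rfl rfl ?_
    simpa [machNext, machOut, gatesCode, encodeGate, constCode, axFlag] using Run.refl 0 _
  | cons l C ih =>
    intro v f
    rw [encodeList, List.length_cons, List.length_append, List.cons_append, List.append_assoc]
    refine run_inp rfl rfl ?_
    exact (run_clause_literal l).trans (ih _ _)

theorem encodeNat_sixteen_mul_add_fifteen (k : ℕ) :
    encodeNat (16 * k + 15) = digits 15 ++ (bits k ++ [Sym.endNat]) :=
  encodeNat_sixteen_mul_add k (by norm_num) (by norm_num)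

theorem run_rule {i : List Sym} (R : Rule Name) (o : List Sym) :
    (machine mono).Run (encodeRule R).length (some .rule, stks (encodeRule R ++ i) o c [] r)
      (some (.copy R.kind 0),
        stks i ((gatesCode (headGates R) ++ seg mono R.kind 0).reverse ++ o) c [] r) := by
  have h0 : encodeNat 0 = [Sym.endNat] := rfl
  cases R with
  | ax C => exact run_inp rfl rfl (run_clause C _ _)
  | inst n =>
    refine run_inp rfl rfl ?_
    simpa [machNext, machOut, gatesCode, encodeGate, afterNum, labAfterNum, Rule.kind, headGates,
      refCode, constCode, encodeNat_sixteen_mul_add_fifteen, h0] using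
      run_num (mono := mono) (c := c) (r := r) (m := .only) (i := i) n (refCode.reverse ++ o)
  | merge n =>
    refine run_inp rfl rfl ?_
    simpa [machNext, machOut, gatesCode, encodeGate, afterNum, labAfterNum, Rule.kind, headGates,
      refCode, constCode, encodeNat_sixteen_mul_add_fifteen, h0] using
      run_num (mono := mono) (c := c) (r := r) (m := .only) (i := i) n (refCode.reverse ++ o)
  | res n m x =>
    rw [encodeRule, List.length_cons, List.length_append, List.length_append, List.cons_append,
      List.append_assoc, List.append_assoc]
    refine run_inp rfl rfl ?_
    refine (run_num (m := .left) n _).trans ((run_num (m := .right) m _).trans ?_)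
    simpa [machOut, gatesCode, encodeGate, afterNum, labAfterNum, Rule.kind, headGates, refCode,
      encodeNat_sixteen_mul_add_fifteen, h0] using
      run_name (mono := mono) (c := c) (r := r) (i := i) x ((gatesCode
        [Gate.or (16 * n + 15) 0, Gate.or (16 * m + 15) 0]).reverse ++ o)

/-! #### Skipping the annotated clause -/

theorem run_skip_word {i o : List Sym} (w : List Sym) (hw : Sym.nil ∉ w) :
    (machine mono).Run w.length (some .skipInner, stks (w ++ i) o c [] r)
      (some .skipInner, stks i o c [] r) := by
  induction w with
  | nil => exact .refl _ _
  | cons s w ih =>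
    simp only [List.mem_cons, not_or] at hw
    refine run_inp rfl rfl ?_
    have h : machNext .skipInner (some s) = some .skipInner := by
      cases s <;> simp [machNext] at hw ⊢
    rw [h]
    exact ih hw.2

theorem nil_notMem_encodeName (x : Name) : Sym.nil ∉ encodeName x := by
  cases x <;> simp [encodeName, encodeNat]

/-- The only `nil` in the code of an annotated literal is the end of its annotation, so the two
skipping states suffice to parse the nested lists. -/
theorem exists_encodeRawALit_eq (l : RawALit Name) :
    ∃ w, encodeRawALit l = w ++ [Sym.nil] ∧ Sym.nil ∉ w := by
  refine ⟨_, by rw [encodeRawALit, encodeList_eq, ← List.append_assoc], ?_⟩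
  simp only [List.mem_append, List.mem_flatMap, List.mem_cons, encodeLiteral, not_exists, not_and,
    reduceCtorEq, false_or, nil_notMem_encodeName, or_false]
  intro x _
  cases x.2 <;> simp [encodeVal]

theorem run_skip {i o : List Sym} (D : List (RawALit Name)) :
    (machine mono).Run (encodeList encodeRawALit D).length
      (some .skipOuter, stks (encodeList encodeRawALit D ++ i) o c [] r)
      (some .inc, stks i o c [] r) := by
  induction D with
  | nil => exact run_inp rfl rfl (.refl _ _)
  | cons l D ih =>
    obtain ⟨w, hw, hnil⟩ := exists_encodeRawALit_eq l
    rw [encodeList, hw, List.length_cons, List.append_assoc, List.length_append]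
    simp only [List.cons_append, List.append_assoc, List.nil_append, List.length_cons]
    refine run_inp rfl rfl ?_
    exact (run_skip_word w hnil).trans (run_inp rfl rfl ih)

/-! #### The line number -/

theorem run_incBack {i o : List Sym} (t : List Sym) : ∀ c,
    (machine mono).Run (t.length + 1) (some .incBack, stks i o c t r)
      (some .start, stks i o (t.reverse ++ c) [] r) := by
  induction t with
  | nil => exact fun c => .head (.refl _ _) (Prod.ext rfl (funext fun k => by cases k <;> rfl))
  | cons s t ih =>
    intro c
    refine .head (c := (some .incBack, stks i o (s :: c) t r)) ?_
      (Prod.ext rfl (funext fun k => by cases k <;> rfl))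
    simpa using ih (s :: c)

theorem run_incBits {i o : List Sym} (w : List Bool) : ∀ t,
    (machine mono).Run (2 * w.length + t.length + 2) (some .inc, stks i o (w.map Sym.bit) t r)
      (some .start, stks i o (t.reverse ++ (incBits w).map Sym.bit) [] r) := by
  induction w with
  | nil =>
    intro t
    refine (Run.head (run_incBack t [Sym.bit true]) (Prod.ext rfl (funext fun k => ?_))).le
      (by simp)
    cases k <;> rfl
  | cons b w ih =>
    intro t
    cases b with
    | false =>
      refine (Run.head (run_incBack t (Sym.bit true :: w.map Sym.bit))
        (Prod.ext rfl (funext fun k => ?_))).le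
        (by simp only [List.length_cons]; omega)
      cases k <;> rfl
    | true =>
      have h := ih (Sym.bit false :: t)
      rw [List.reverse_cons, List.append_assoc] at h
      refine (Run.head h (Prod.ext rfl (funext fun k => ?_))).le
        (by simp only [List.length_cons]; omega)
      cases k <;> rfl

theorem run_inc {i o : List Sym} (k : ℕ) :
    (machine mono).Run (2 * k + 2) (some .inc, stks i o (bits k) [] r)
      (some .start, stks i o (bits (k + 1)) [] r) := by
  have h := run_incBits (mono := mono) (i := i) (o := o) (r := r) (Computability.encodeNat k) []
  rw [← encodeNat_succ] at h
  have := length_encodeNat_le k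
  exact h.le (by simp; omega)

/-! #### The whole computation -/

theorem run_line {i o : List Sym} (ln : Line Name) (k : ℕ) :
    (machine mono).Run ((encodeLine ln).length + 1 + (18 * k + 18))
      (some .start, stks (Sym.cons :: (encodeLine ln ++ i)) o (bits k) [] r)
      (some .start, stks i ((gatesCode (block mono k ln.rule)).reverse ++ o)
        (bits (k + 1)) [] r) := by
  have hk : (bits k).length ≤ k := by simpa [bits] using length_encodeNat_le k
  have h : (machine mono).Run ((encodeRule ln.rule).length + (8 * (2 * (bits k).length + 2) +
      ((encodeList encodeRawALit ln.clause).length + (2 * k + 2))) + 1)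
      (some .start, stks (Sym.cons :: (encodeLine ln ++ i)) o (bits k) [] r)
      (some .start, stks i ((gatesCode (block mono k ln.rule)).reverse ++ o)
        (bits (k + 1)) [] r) := by
    refine run_inp rfl rfl ?_
    rw [encodeLine, List.append_assoc]
    refine (run_rule ln.rule _).trans ?_
    rw [List.reverse_append, List.append_assoc]
    refine run_tail.trans ((run_skip ln.clause).trans ?_)
    simpa [machOut, block, gatesCode] using run_inc k
  -- Eight copies of the line number and one increment take at most 8(2k + 2) + (2k + 2) = 18k + 18
  -- steps, with the crude bound `k` for the number of digits.
  refine h.le ?_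
  simp only [encodeLine, List.length_append]
  omega

theorem run_lines (π : Proof Name) : ∀ (k : ℕ) (o : List Sym),
    (machine mono).Run ((encodeProof π).length + π.length * (18 * (k + π.length) + 18))
      (some .start, stks (encodeProof π) o (bits k) [] r)
      (some .clear, stks [] ((gatesCode (blocks mono k π) ++ [Sym.nil]).reverse ++ o)
        (bits (k + π.length)) [] r) := by
  induction π with
  | nil =>
    intro k o
    refine (run_inp (n := 0) rfl rfl ?_).le (by simp [encodeProof, encodeList])
    exact .refl _ _
  | cons ln π ih =>
    intro k o
    have h := (run_line (mono := mono) (r := r) (i := encodeProof π) (o := o) ln k).trans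
      (ih (k + 1) _)
    refine Run.le (n := (encodeLine ln).length + 1 + (18 * k + 18) + ((encodeProof π).length +
      π.length * (18 * (k + 1 + π.length) + 18))) ?_ ?_
    · simpa [gatesCode, blocks, encodeProof, encodeList, ← Nat.add_assoc,
        Nat.add_right_comm k 1] using h
    · simp only [encodeProof, encodeList, List.length_cons, List.length_append]
      nlinarith

theorem run_clear {i o : List Sym} (c : List Sym) :
    (machine mono).Run (c.length + 1) (some .clear, stks i o c [] r)
      (some .rev, stks i o [] [] r) := by
  induction c with
  | nil => exact .head (.refl _ _) (Prod.ext rfl (funext fun k => by cases k <;> rfl))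
  | cons s c ih => exact .head ih (Prod.ext rfl (funext fun k => by cases k <;> rfl))

theorem run_rev (o : List Sym) : ∀ r,
    (machine mono).Run (o.length + 1) (some .rev, stks [] o [] [] r)
      (none, stks [] [] [] [] (o.reverse ++ r)) := by
  induction o with
  | nil => exact fun r => .head (.refl _ _) (Prod.ext rfl (funext fun k => by cases k <;> rfl))
  | cons s o ih =>
    intro r
    refine .head (c := (some .rev, stks [] o [] [] (s :: r))) ?_
      (Prod.ext rfl (funext fun k => by cases k <;> rfl))
    simpa using ih (s :: r)

theorem run_machine {B : ℕ} (hB : ∀ l v, ((machine mono).act l v).length ≤ B) (π : Proof Name) :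
    (machine mono).Run ((1 + B) * ((encodeProof π).length +
        (encodeProof π).length * (18 * (encodeProof π).length + 18)) + (encodeProof π).length + 2)
      (some .start, stks (encodeProof π) [] [] [] [])
      (none, stks [] [] [] [] (encodeCircuit (extract mono π))) := by
  have hπ : π.length ≤ (encodeProof π).length := by
    induction π with
    | nil => simp
    | cons ln π ih =>
      simp only [encodeProof, encodeList, List.length_cons, List.length_append] at *
      omega
  set n := (encodeProof π).length
  have h1 := run_lines (mono := mono) (r := []) π 0 []
  have h1 := h1.le (m := n + n * (18 * n + 18)) (by gcongr; omega)
  -- The output has at most `B` symbols per step made so far, which accounts for the factor `1 + B`.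
  have hlen := h1.length_le hB .out
  have h2 := (h1.trans (run_clear _)).trans (run_rev _ _)
  have hbits : (bits (0 + π.length)).length ≤ n := by
    simpa [bits] using (length_encodeNat_le π.length).trans hπ
  simp only [stks, List.append_nil, List.length_nil, Nat.zero_add, List.reverse_reverse]
    at hlen h2 hbits
  rw [encodeCircuit, encodeList_eq]
  refine h2.le ?_
  nlinarith

end

/-- The extraction of a circuit takes polynomial time. -/
theorem polyTimeExtraction_extract (mono : Bool) : PolyTimeExtraction (extract mono) := by
  obtain ⟨B, hB⟩ := (machine mono).exists_act_bound
  let tm : Turing.FinTM2 :=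
    { K := Stk
      k₀ := .inp
      k₁ := .res
      Γ := fun _ => Sym
      Λ := Lab
      main := .start
      σ := Option Sym
      initialState := none
      Γk₀Fin := inferInstanceAs (Fintype Sym)
      m := (machine mono).stmt }
  have hinit : ∀ w : List Sym, Turing.initList tm w = ⟨some .start, none, stks w [] [] [] []⟩ := by
    intro w
    simp only [Turing.initList]
    congr 1
    funext k
    cases k <;> rfl
  have hhalt : ∀ w : List Sym, Turing.haltList tm w = ⟨none, none, stks [] [] [] [] w⟩ := by
    intro w
    simp only [Turing.haltList]
    congr 1
    funext k
    cases k <;> rfl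
  refine ⟨{ tm := tm
            inputAlphabet := Equiv.refl Sym
            outputAlphabet := Equiv.refl Sym
            time := (1 + Polynomial.C B) * (Polynomial.X + Polynomial.X *
              (18 * Polynomial.X + 18)) + Polynomial.X + 2
            outputsFun := fun π => ?_ }⟩
  -- The number of steps is data in `outputsFun`, whereas only its existence has been proved.
  apply Classical.choice
  obtain ⟨m, hm, h⟩ := (run_machine hB π).iterate
  refine ⟨⟨⟨m, ?_⟩, ?_⟩⟩
  · simp only [Equiv.invFun_as_coe, Option.map_some]
    have hid : ∀ w : List Sym, w.map (Equiv.refl Sym).symm = w := List.map_id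
    rw [hinit, hhalt, hid, hid]
    exact h
  · simpa using hm

end IRM

theorem theorem5p3 :
    (∃ f : IRM.Proof IRM.Name → IRM.Circuit, IRM.PolyTimeExtraction f ∧
      ∀ (F : IRM.Setting) (π : IRM.Proof IRM.Name), IRM.IsRefutation F.withB π →
        F.ComputesB (f π)) ∧
    (∃ f : IRM.Proof IRM.Name → IRM.Circuit, IRM.PolyTimeExtraction f ∧
      ∀ (F : IRM.Setting) (π : IRM.Proof IRM.Name), IRM.IsRefutation F.withB π →
        F.PositiveInA → (f π).Monotone ∧ F.ComputesB (f π)) :=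
  ⟨⟨IRM.extract false, IRM.polyTimeExtraction_extract false, fun _ _ hπ =>
      IRM.Setting.computesB_extract (by simp) hπ⟩,
    ⟨IRM.extract true, IRM.polyTimeExtraction_extract true, fun _ π hπ hA =>
      ⟨IRM.monotone_extract π, IRM.Setting.computesB_extract (fun _ => hA) hπ⟩⟩⟩
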